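/- **Setup.** There are two tasks $A,B$ and $J\ge 3$ groups of workers, each of unit mass. In group $j$ a worker's privately known type $\theta$ (cost of task $A$ relative to task $B$) has distribution function $F_j$ with a strictly positive density on $[\underline\theta_j,\bar\theta_j]$, $0<\underline\theta_j<\bar\theta_j$; the reservation workload is $R_j:[\underline\theta_j,\bar\theta_j]\to[0,\infty)$; the firm's marginal costs of assigning the tasks are $\pi_j=(\pi_j^A,\pi_j^B)$ with $\pi_j^A,\pi_j^B>0$, and $\pi_i^k\ne\pi_j^k$ for $i\neq j$, $k\in\{A,B\}$. The incentive-feasible set of group $j$ is the set of all $(\mathbb E_j[a(\theta)],\mathbb E_j[b(\theta)])$ with $a,b:[\underline\theta_j,\bar\theta_j]\to[0,\infty)$ such that $\theta a(\theta)+b(\theta)\le\theta a(\theta')+b(\theta')$ and $\theta a(\theta)+b(\theta)\le R_j(\theta)$ for all $\theta,\theta'$. Assume that all groups have the same incentive-feasible set $\mathcal F$, and let $S(w)=\max_{n\in\mathcal F}w\cdot n$ be its support function. For a labor allocation $\ell=(\ell^A,\ell^B)$ with $\ell/J\in\mathcal F$, the dual program is $$\sup_{\lambda\in\mathbb R^2}\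 \lambda\cdot\ell-\sum_{j=1}^J S(\lambda-\pi_j),$$ and $\lambda_*(\ell)$ is its (possibly empty) set of solutions. For $k\in\{A,B\}$ let $$\max\lambda_*^k(\ell):=\inf_{\varepsilon>0}\ \sup\{\lambda^k:\lambda\text{ is optimal in the dual program up to }\varepsilon\}\in[-\infty,+\infty];$$ this is the largest limit of $\lambda^k$ along maximizing sequences, and it is the largest $k$-component of a solution when the set of solutions is nonempty and bounded. The equilibrium set is $$\mathcal E=\{x\in\mathcal F:\max\lambda_*^A(Jx)\ge0\text{ and }\max\lambda_*^B(Jx)\ge0\}.$$ Heterogeneity is low in group $j$ if $1-\underline\theta_j/\theta\le F_j(\theta)\le\theta/\bar\theta_j$ for all $\theta\in[\underline\theta_j,\bar\theta_j]$, and it is low if it is low in every group. The frontier of $\mathcal F$ is the set of points of $\mathcal F$ that maximize $w\cdot n$ over $n\in\mathcal F$ for some $w$ with a strictly positive component; such a $w$ is a normal at the point. A frontier point is on the upward-sloping segment if it has a normal $w$ with $w^Aw^B<0$, and on the downward-sloping segment if it has a normal $w\ge0$, $w\neq0$. It is a kink if $\mathcal F$ has two non-parallel supporting lines there. The frontier is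 strictly convex if every proper convex combination of two distinct frontier points is interior to $\mathcal F$. **Statement.** 1. If heterogeneity is low, then $\mathcal E=\mathcal F$. Conversely, if $\mathcal E=\mathcal F$, then heterogeneity is low, provided that the frontier is strictly convex and that for every $j$ there is $\kappa>0$ such that, for all $\theta\in[\underline\theta_j,\bar\theta_j]$, $R_j(\theta)\ge R_j(\underline\theta_j)+\kappa(\theta-\underline\theta_j)$ and $R_j(\theta)/\theta\ge R_j(\bar\theta_j)/\bar\theta_j+\kappa(\bar\theta_j-\theta)$. 2. (i) If the frontier is strictly convex, then $\mathcal E$ contains no point of the upward-sloping segment that is not a kink, except possibly a point whose normal is parallel to all of the differences $\pi_i-\pi_j$. (There is no such exception if the vectors $\pi_j$ do not all lie on one line.) (ii) $\mathcal E$ contains every point of the downward-sloping segment. (iii) Let $\ell^A\le\hat\ell^A$ with $(\ell^A/J,\ell^B/J)$ and $(\hat\ell^A/J,\ell^B/J)$ in $\mathcal F$. If $\max\lambda_*^A(\ell^A,\ell^B)\ge0$, then $\max\lambda_*^A(\hat\ell^A,\ell^B)\ge0$. Moreover, if $\ell^A<\hat\ell^A$ and some solution of the dual program at $(\ell^A,\ell^B)$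 has $\lambda^A\ge0$, then every solution at $(\hat\ell^A,\ell^B)$ has $\lambda^A\ge0$. The same holds with the roles of $A$ and $B$ exchanged. -/

import Mathlib

open Set

namespace TaskAllocation

noncomputable section

/-- The pairing `w^A n^A + w^B n^B` on pairs of (task `A`, task `B`) quantities. -/
def pairing (w n : ℝ × ℝ) : ℝ := w.1 * n.1 + w.2 * n.2

/-- A unit-mass group of workers. The type `θ` is a worker's cost of task `A` relative to task `B`;
it has a strictly positive density on `[lo, hi]` with `0 < lo`. `R` is the reservation workload
and `costA`, `costB` are the firm's marginal costs of assigning the tasks to the group. -/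
structure WorkerGroup where
  lo : ℝ
  hi : ℝ
  density : ℝ → ℝ
  R : ℝ → ℝ
  costA : ℝ
  costB : ℝ
  lo_pos : 0 < lo
  lo_lt_hi : lo < hi
  density_pos : ∀ θ ∈ Icc lo hi, 0 < density θ
  density_integrable : MeasureTheory.IntegrableOn density (Icc lo hi)
  density_mass : ∫ θ in lo..hi, density θ = 1
  R_nonneg : ∀ θ ∈ Icc lo hi, 0 ≤ R θ
  costA_pos : 0 < costA
  costB_pos : 0 < costB

namespace WorkerGroup

/-- The distribution function of the type, on `[lo, hi]`. -/
def cdf (g : WorkerGroup) (θ : ℝ) : ℝ := ∫ z in g.lo..θ, g.density z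

/-- The expectation of a function of the type. -/
def expect (g : WorkerGroup) (a : ℝ → ℝ) : ℝ := ∫ θ in g.lo..g.hi, a θ * g.density θ

/-- The performance vector `(π^A, π^B)`. -/
def cost (g : WorkerGroup) : ℝ × ℝ := (g.costA, g.costB)

/-- `(a, b)` is a nonnegative, incentive compatible and individually rational direct mechanism.
(Incentive compatibility makes `a` non-increasing and `θ * a θ + b θ` continuous on `[lo, hi]`, so
both components are bounded and measurable there.) -/
structure IsMechanism (g : WorkerGroup) (a b : ℝ → ℝ) : Prop where
  nonneg_a : ∀ θ ∈ Icc g.lo g.hi, 0 ≤ a θ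
  nonneg_b : ∀ θ ∈ Icc g.lo g.hi, 0 ≤ b θ
  ic : ∀ θ ∈ Icc g.lo g.hi, ∀ θ' ∈ Icc g.lo g.hi, a θ * θ + b θ ≤ a θ' * θ + b θ'
  ir : ∀ θ ∈ Icc g.lo g.hi, a θ * θ + b θ ≤ g.R θ

/-- The incentive-feasible set: aggregate allocations induced by some mechanism. -/
def feasibleSet (g : WorkerGroup) : Set (ℝ × ℝ) :=
  {n | ∃ a b : ℝ → ℝ, g.IsMechanism a b ∧ n = (g.expect a, g.expect b)}

/-- The support function of the incentive-feasible set. -/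
def support (g : WorkerGroup) (w : ℝ × ℝ) : ℝ := sSup (pairing w '' g.feasibleSet)

/-- Low preference heterogeneity. -/
def LowHeterogeneity (g : WorkerGroup) : Prop :=
  ∀ θ ∈ Icc g.lo g.hi, 1 - g.lo / θ ≤ g.cdf θ ∧ g.cdf θ ≤ θ / g.hi

/-- The reservation workload rises from its value at the lowest type at a positive rate. For
non-decreasing `R` this says that `R` has a positive lower right derivative at `lo`. -/
def RisesFromLowest (g : WorkerGroup) : Prop :=
  ∃ κ > 0, ∀ θ ∈ Icc g.lo g.hi, g.R g.lo + κ * (θ - g.lo) ≤ g.R θ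

/-- The same condition after exchanging the two tasks, which turns the type `θ` into `1 / θ` and
the reservation workload `R θ` into `R θ / θ`. -/
def RisesFromHighest (g : WorkerGroup) : Prop :=
  ∃ κ > 0, ∀ θ ∈ Icc g.lo g.hi, g.R g.hi / g.hi + κ * (g.hi - θ) ≤ g.R θ / θ

end WorkerGroup

/-- `x` is a point of `F` that maximizes the weights `w` over `F`. -/
def IsMaximizer (F : Set (ℝ × ℝ)) (w x : ℝ × ℝ) : Prop :=
  x ∈ F ∧ ∀ y ∈ F, pairing w y ≤ pairing w x

/-- The frontier: maximizers for weights with at least one strictly positive component. -/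
def frontierSet (F : Set (ℝ × ℝ)) : Set (ℝ × ℝ) :=
  {x | ∃ w : ℝ × ℝ, ¬ w ≤ 0 ∧ IsMaximizer F w x}

/-- Every proper convex combination of two distinct frontier points is interior. -/
def StrictlyConvexFrontier (F : Set (ℝ × ℝ)) : Prop :=
  ∀ x ∈ frontierSet F, ∀ y ∈ frontierSet F, x ≠ y → openSegment ℝ x y ⊆ interior F

/-- `F` has two non-parallel supporting lines at `x`. -/
def IsKink (F : Set (ℝ × ℝ)) (x : ℝ × ℝ) : Prop :=
  ∃ w w' : ℝ × ℝ, IsMaximizer F w x ∧ IsMaximizer F w' x ∧ w.1 * w'.2 ≠ w.2 * w'.1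

variable {J : ℕ}

/-- The objective of the dual outer program at prices `p = (λ^A, λ^B)`, given the aggregate
allocation `l = (ℓ^A, ℓ^B)` to labor. -/
def dualObjective (G : Fin J → WorkerGroup) (l p : ℝ × ℝ) : ℝ :=
  pairing p l - ∑ j, (G j).support (p - (G j).cost)

/-- Prices that are optimal in the dual outer program up to `ε`. -/
def approxDualSolutions (G : Fin J → WorkerGroup) (ε : ℝ) (l : ℝ × ℝ) : Set (ℝ × ℝ) :=
  {p | ∀ q : ℝ × ℝ, dualObjective G l q ≤ dualObjective G l p + ε}

/-- The solutions `λ_*(ℓ)` of the dual outer program. -/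
def dualSolutions (G : Fin J → WorkerGroup) (l : ℝ × ℝ) : Set (ℝ × ℝ) :=
  approxDualSolutions G 0 l

/-- The largest shadow price of task `A`, as an extended real: the largest limit of the
`A`-components along maximizing sequences of the dual outer program. (At most frontier points the
supremum in the dual is not attained, and the shadow prices are `±∞`.) -/
def maxPriceA (G : Fin J → WorkerGroup) (l : ℝ × ℝ) : EReal :=
  ⨅ (ε : ℝ) (_ : 0 < ε), ⨆ p ∈ approxDualSolutions G ε l, ((p.1 : ℝ) : EReal)

/-- The largest shadow price of task `B`. -/
def maxPriceB (G : Fin J → WorkerGroup) (l : ℝ × ℝ) : EReal :=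
  ⨅ (ε : ℝ) (_ : 0 < ε), ⨆ p ∈ approxDualSolutions G ε l, ((p.2 : ℝ) : EReal)

/-- The equilibrium set, in per-group allocations `x = ℓ / J`, when `F` is the common
incentive-feasible set of the groups. -/
def equilibriumSet (G : Fin J → WorkerGroup) (F : Set (ℝ × ℝ)) : Set (ℝ × ℝ) :=
  {x | x ∈ F ∧ 0 ≤ maxPriceA G ((J : ℝ) • x) ∧ 0 ≤ maxPriceB G ((J : ℝ) • x)}

end

end TaskAllocation

open Filter Topology MeasureTheory

namespace TaskAllocation

noncomputable section

/-! At `ℓ = J • x` the dual objective is a constant minus `∑ j, gapFn F x (λ - π_j)`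
(`dualObjective_smul`). The gap is sublinear, nonnegative for `x ∈ F`, and zero exactly at the
normals of `F` at `x`. Each claim about shadow prices thus asks which prices make all gaps small.

Adding a multiple of a normal never raises a gap. On the downward-sloping segment this moves any
price to one with a nonnegative chosen component; an axis-parallel normal needs a separate
comparison. Under low heterogeneity the largest feasible amount of either task is attained without
the other, and a negative price can be raised to zero at no loss. The reason is the envelope
formula: `E[b]` is the workload of the lowest type plus `∫ a (1 - F - θ f)`, and low heterogeneity
is the sign of the primitive of the kernel; the second mean value theorem applies since `a`
decreases. Task `A` is analogous.

At an upward-sloping point that is not a kink the normals form one ray. Small gaps for two groups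
whose cost difference is not parallel to the ray force `λ` far out along it
(`exists_gap_forces_far`), so one price is bounded away from zero on the negative side.

For the converse, strict convexity makes the maximizer of `(-s, 1)` continuous in `s`, and kinks
account for only countably many maximizers. If the maximum of task `B` needed some task `A`, a
non-kink outside the equilibrium set would exist. So the maximum is at most `R lo`, which a two-step
menu exceeds when the lower bound on the distribution function fails. The upper bound follows by
exchanging the tasks.

Monotonicity in quantities is a comparative-statics argument: raising `ℓ^A` adds a multiple of `λ^A`
to the objective. -/

theorem pairing_add (u v n : ℝ × ℝ) : pairing (u + v) n = pairing u n + pairing v n := by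
  simp only [pairing, Prod.fst_add, Prod.snd_add]; ring

theorem pairing_sub (u v n : ℝ × ℝ) : pairing (u - v) n = pairing u n - pairing v n := by
  simp only [pairing, Prod.fst_sub, Prod.snd_sub]; ring

theorem pairing_smul (t : ℝ) (u n : ℝ × ℝ) : pairing (t • u) n = t * pairing u n := by
  simp only [pairing, Prod.smul_fst, Prod.smul_snd, smul_eq_mul]; ring

theorem pairing_smul_right (t : ℝ) (u n : ℝ × ℝ) : pairing u (t • n) = t * pairing u n := by
  simp only [pairing, Prod.smul_fst, Prod.smul_snd, smul_eq_mul]; ring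

theorem continuous_pairing : Continuous fun z : (ℝ × ℝ) × (ℝ × ℝ) => pairing z.1 z.2 := by
  unfold pairing; fun_prop

theorem continuous_pairing_right (w : ℝ × ℝ) : Continuous fun n => pairing w n := by
  unfold pairing; fun_prop

/-- The support function of a set of allocations. -/
def supportFn (F : Set (ℝ × ℝ)) (w : ℝ × ℝ) : ℝ := sSup (pairing w '' F)

/-- The loss in the value of `x` at weights `w` relative to the support function. -/
def gapFn (F : Set (ℝ × ℝ)) (x w : ℝ × ℝ) : ℝ := supportFn F w - pairing w x

/-! ### Support functions, gaps and normals. -/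

section Support

variable {F : Set (ℝ × ℝ)} {x w : ℝ × ℝ}

theorem pairing_le_supportFn (hF : IsCompact F) (w : ℝ × ℝ) {n : ℝ × ℝ} (hn : n ∈ F) :
    pairing w n ≤ supportFn F w :=
  le_csSup (hF.image (continuous_pairing_right w)).bddAbove (mem_image_of_mem _ hn)

theorem supportFn_le (hne : F.Nonempty) {c : ℝ} (h : ∀ n ∈ F, pairing w n ≤ c) :
    supportFn F w ≤ c :=
  csSup_le (hne.image _) (by rintro _ ⟨n, hn, rfl⟩; exact h n hn)

theorem exists_isMaximizer (hF : IsCompact F) (hne : F.Nonempty) (w : ℝ × ℝ) :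
    ∃ x, IsMaximizer F w x := by
  obtain ⟨x, hx, h⟩ := hF.exists_isMaxOn hne (continuous_pairing_right w).continuousOn
  exact ⟨x, hx, fun y hy => h hy⟩

theorem continuous_supportFn (hF : IsCompact F) : Continuous (supportFn F) :=
  hF.continuous_sSup (f := fun w n => pairing w n) continuous_pairing

theorem continuous_gapFn (hF : IsCompact F) (x : ℝ × ℝ) : Continuous (gapFn F x) := by
  have := continuous_supportFn hF
  unfold gapFn pairing
  fun_prop

theorem le_gapFn (hF : IsCompact F) (x w : ℝ × ℝ) {n : ℝ × ℝ} (hn : n ∈ F) :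
    pairing w n - pairing w x ≤ gapFn F x w :=
  sub_le_sub_right (pairing_le_supportFn hF w hn) _

theorem gapFn_le (hne : F.Nonempty) {c : ℝ} (h : ∀ n ∈ F, pairing w n - pairing w x ≤ c) :
    gapFn F x w ≤ c := by
  have : supportFn F w ≤ c + pairing w x := supportFn_le hne fun n hn => by linarith [h n hn]
  unfold gapFn; linarith

theorem gapFn_nonneg (hF : IsCompact F) (hx : x ∈ F) (w : ℝ × ℝ) : 0 ≤ gapFn F x w := by
  simpa using le_gapFn hF x w hx

theorem IsMaximizer.gapFn_le_zero (hx : IsMaximizer F w x) : gapFn F x w ≤ 0 :=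
  gapFn_le ⟨x, hx.1⟩ fun n hn => by linarith [hx.2 n hn]

theorem isMaximizer_of_gapFn_le_zero (hF : IsCompact F) (hx : x ∈ F) (h : gapFn F x w ≤ 0) :
    IsMaximizer F w x :=
  ⟨hx, fun n hn => by linarith [le_gapFn hF x w hn]⟩

theorem gapFn_add_le (hF : IsCompact F) (hne : F.Nonempty) (u v : ℝ × ℝ) :
    gapFn F x (u + v) ≤ gapFn F x u + gapFn F x v :=
  gapFn_le hne fun n hn => by
    rw [pairing_add, pairing_add]
    linarith [le_gapFn hF x u hn, le_gapFn hF x v hn]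

theorem gapFn_smul_le (hF : IsCompact F) (hne : F.Nonempty) {t : ℝ} (ht : 0 ≤ t) (u : ℝ × ℝ) :
    gapFn F x (t • u) ≤ t * gapFn F x u :=
  gapFn_le hne fun n hn => by
    rw [pairing_smul, pairing_smul, ← mul_sub]
    exact mul_le_mul_of_nonneg_left (le_gapFn hF x u hn) ht

/-- Sublinearity together with a nonpositive gap at `w` makes movement along a normal free. This is
the tool for shifting prices. -/
theorem IsMaximizer.gapFn_add_smul_le (hF : IsCompact F) (hx : IsMaximizer F w x) {t : ℝ}
    (ht : 0 ≤ t) (u : ℝ × ℝ) : gapFn F x (u + t • w) ≤ gapFn F x u := by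
  have hne : F.Nonempty := ⟨x, hx.1⟩
  have h1 := gapFn_add_le (x := x) hF hne u (t • w)
  have h2 := gapFn_smul_le (x := x) hF hne ht w
  have h3 := mul_nonpos_of_nonneg_of_nonpos ht hx.gapFn_le_zero
  linarith

theorem IsMaximizer.smul (hx : IsMaximizer F w x) {t : ℝ} (ht : 0 ≤ t) :
    IsMaximizer F (t • w) x :=
  ⟨hx.1, fun y hy => by
    rw [pairing_smul, pairing_smul]; exact mul_le_mul_of_nonneg_left (hx.2 y hy) ht⟩

theorem IsMaximizer.add {w' : ℝ × ℝ} (hx : IsMaximizer F w x) (hx' : IsMaximizer F w' x) :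
    IsMaximizer F (w + w') x :=
  ⟨hx.1, fun y hy => by
    rw [pairing_add, pairing_add]; exact add_le_add (hx.2 y hy) (hx'.2 y hy)⟩

/-- Weights that are maximized at an interior point vanish. -/
theorem IsMaximizer.eq_zero_of_mem_interior (hx : IsMaximizer F w x) (hi : x ∈ interior F) :
    w = 0 := by
  have hc : Tendsto (fun t : ℝ => x + t • w) (𝓝 0) (𝓝 x) := by
    have : Continuous fun t : ℝ => x + t • w := by fun_prop
    simpa using this.tendsto 0
  have h1 : ∀ᶠ t : ℝ in 𝓝[>] 0, x + t • w ∈ F :=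
    (hc.mono_left nhdsWithin_le_nhds).eventually (mem_interior_iff_mem_nhds.1 hi)
  obtain ⟨t, htF, ht⟩ := (h1.and self_mem_nhdsWithin).exists
  have h2 := hx.2 _ htF
  have ht' : 0 < t := ht
  simp only [pairing, Prod.fst_add, Prod.snd_add, Prod.smul_fst, Prod.smul_snd,
    smul_eq_mul] at h2
  have h3 : t * (w.1 * w.1 + w.2 * w.2) ≤ 0 := by linarith
  have h4 : w.1 * w.1 + w.2 * w.2 ≤ 0 := by
    by_contra h
    push Not at h
    linarith [mul_pos ht' h]
  have h5 : w.1 = 0 := by nlinarith [mul_self_nonneg w.1, mul_self_nonneg w.2]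
  have h6 : w.2 = 0 := by nlinarith [mul_self_nonneg w.1, mul_self_nonneg w.2]
  exact Prod.ext h5 h6

/-- The midpoint of two distinct maximizers would be an interior maximizer, forcing `w = 0`. -/
theorem IsMaximizer.unique (hs : StrictlyConvexFrontier F) (hw : ¬ w ≤ 0) {y : ℝ × ℝ}
    (hx : IsMaximizer F w x) (hy : IsMaximizer F w y) : y = x := by
  by_contra hne
  have hm : (1 / 2 : ℝ) • y + (1 / 2 : ℝ) • x ∈ interior F :=
    hs y ⟨w, hw, hy⟩ x ⟨w, hw, hx⟩ hne ⟨1 / 2, 1 / 2, by norm_num, by norm_num, by norm_num, rfl⟩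
  have hmax : IsMaximizer F w ((1 / 2 : ℝ) • y + (1 / 2 : ℝ) • x) := by
    refine ⟨interior_subset hm, fun z hz => ?_⟩
    have h1 := hx.2 z hz
    have h2 := hy.2 z hz
    have h3 : pairing w ((1 / 2 : ℝ) • y + (1 / 2 : ℝ) • x)
        = (1 / 2) * pairing w y + (1 / 2) * pairing w x := by
      simp only [pairing, Prod.fst_add, Prod.snd_add, Prod.smul_fst, Prod.smul_snd, smul_eq_mul]
      ring
    rw [h3]; linarith
  exact hw (hmax.eq_zero_of_mem_interior hm).le

end Support

/-! ### Raising a price to a nonnegative value without loss. -/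

section Downward

variable {F : Set (ℝ × ℝ)} {x w : ℝ × ℝ}

/-- At a maximizer of nonnegative weights, prices can be replaced by prices with a nonnegative
first component without loss. -/
theorem IsMaximizer.exists_price_fst_nonneg (hF : IsCompact F) (hx : IsMaximizer F w x)
    (hw : 0 ≤ w) (hw0 : w ≠ 0) {ι : Type*} [Fintype ι] (c : ι → ℝ × ℝ) (hc : ∀ i, 0 < (c i).1)
    (p : ℝ × ℝ) : ∃ q : ℝ × ℝ, 0 ≤ q.1 ∧ ∀ i, gapFn F x (q - c i) ≤ gapFn F x (p - c i) := by
  have hne : F.Nonempty := ⟨x, hx.1⟩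
  rcases (show (0 : ℝ) ≤ w.1 from hw.1).lt_or_eq with h1 | h1
  · refine ⟨p + (|p.1| / w.1) • w, ?_, fun i => ?_⟩
    · have : |p.1| / w.1 * w.1 = |p.1| := div_mul_cancel₀ _ h1.ne'
      simp only [Prod.fst_add, Prod.smul_fst, smul_eq_mul, this]
      linarith [neg_abs_le p.1]
    · rw [add_sub_right_comm]
      exact hx.gapFn_add_smul_le hF (by positivity) _
  · rcases le_or_gt 0 p.1 with hp | hp
    · exact ⟨p, hp, fun i => le_rfl⟩
    have h2 : 0 < w.2 := by
      refine (show (0 : ℝ) ≤ w.2 from hw.2).lt_of_ne fun h => hw0 (Prod.ext h1.symm h.symm)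
    -- `T ≥ p.2` makes the vertical shift a move along the normal `(0, w.2)`; `T ≥ (c i).2` makes
    -- the second weight nonnegative for every `i`.
    set T : ℝ := |p.2| + ∑ i, |(c i).2| with hT
    refine ⟨(0, T), le_rfl, fun i => ?_⟩
    have hTc : (c i).2 ≤ T := by
      have := Finset.single_le_sum (f := fun i => |(c i).2|) (fun i _ => abs_nonneg _)
        (Finset.mem_univ i)
      linarith [le_abs_self (c i).2, abs_nonneg p.2]
    have hTp : p.2 ≤ T := by
      have : 0 ≤ ∑ i, |(c i).2| := Finset.sum_nonneg fun i _ => abs_nonneg _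
      linarith [le_abs_self p.2]
    have hshift : gapFn F x ((p.1, T) - c i) ≤ gapFn F x (p - c i) := by
      have h := hx.gapFn_add_smul_le hF (t := (T - p.2) / w.2)
        (div_nonneg (by linarith) h2.le) (p - c i)
      have he : (p.1, T) - c i = p - c i + ((T - p.2) / w.2) • w := by
        ext
        · simp [← h1]
        · simp only [Prod.snd_sub, Prod.snd_add, Prod.smul_snd, smul_eq_mul,
            div_mul_cancel₀ _ h2.ne']
          ring
      rwa [he]
    refine le_trans ?_ hshift
    -- Since `x` maximizes the second coordinate and the first weight is negative, this maximizer
    -- has `n.1 ≤ x.1`. Raising the first price from `p.1 < 0` to `0` therefore cannot raise the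
    -- gap.
    obtain ⟨n, hn⟩ := exists_isMaximizer hF hne ((0, T) - c i)
    have hgap : gapFn F x ((0, T) - c i)
        ≤ pairing ((0, T) - c i) n - pairing ((0, T) - c i) x :=
      gapFn_le hne fun m hm => by linarith [hn.2 m hm]
    have hgap' := le_gapFn hF x ((p.1, T) - c i) hn.1
    have hn2 : n.2 ≤ x.2 := by
      have := hx.2 n hn.1
      simp only [pairing, ← h1, zero_mul, zero_add] at this
      exact le_of_mul_le_mul_left this h2
    have hnx := hn.2 x hx.1
    simp only [pairing, Prod.fst_sub, Prod.snd_sub] at hnx hgap hgap'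
    have hn1 : n.1 ≤ x.1 := by
      have h3 : (T - (c i).2) * n.2 ≤ (T - (c i).2) * x.2 :=
        mul_le_mul_of_nonneg_left hn2 (by linarith)
      exact le_of_mul_le_mul_left (by linarith : (c i).1 * n.1 ≤ (c i).1 * x.1) (hc i)
    have h4 : 0 ≤ -p.1 * (x.1 - n.1) := mul_nonneg (by linarith) (by linarith)
    nlinarith

/-- If the feasible value of the second task can always be matched without the first task, then
prices can be replaced by prices with a nonnegative first component without loss. -/
theorem exists_price_fst_nonneg_of_dominated (hF : IsCompact F) (hx : x ∈ F)
    (hx1 : ∀ n ∈ F, 0 ≤ n) (h0 : (0 : ℝ × ℝ) ∈ F)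
    (h : ∀ n ∈ F, ∃ m, ((0 : ℝ), m) ∈ F ∧ n.2 ≤ m) {ι : Type*} (c : ι → ℝ × ℝ)
    (hc : ∀ i, 0 < (c i).1)
    (p : ℝ × ℝ) : ∃ q : ℝ × ℝ, 0 ≤ q.1 ∧ ∀ i, gapFn F x (q - c i) ≤ gapFn F x (p - c i) := by
  rcases le_or_gt 0 p.1 with hp | hp
  · exact ⟨p, hp, fun i => le_rfl⟩
  refine ⟨(0, p.2), le_rfl, fun i => gapFn_le ⟨x, hx⟩ fun n hn => ?_⟩
  obtain ⟨m, hm, hnm⟩ := h n hn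
  have h1 := le_gapFn hF x (p - c i) hm
  have h2 := le_gapFn hF x (p - c i) h0
  have h3 := mul_nonneg (hc i).le (hx1 n hn).1
  have h4 : p.1 * x.1 ≤ 0 := mul_nonpos_of_nonpos_of_nonneg hp.le (hx1 x hx).1
  simp only [pairing, Prod.fst_sub, Prod.snd_sub, Prod.fst_zero, Prod.snd_zero] at h1 h2 ⊢
  -- The competitor `n` is beaten by `(0, m)` when the second weight is nonnegative, and by the
  -- origin otherwise.
  rcases le_total 0 (p.2 - (c i).2) with h5 | h5
  · have := mul_le_mul_of_nonneg_left hnm h5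
    linarith
  · have := mul_nonpos_of_nonpos_of_nonneg h5 (hx1 n hn).2
    linarith

end Downward

/-! ### Exposed points that are not kinks. -/

section Smooth

variable {F : Set (ℝ × ℝ)} {x w : ℝ × ℝ}

/-- Far out along the normal of an exposed point, the gap becomes negligible. -/
theorem IsMaximizer.eventually_gapFn_le (hF : IsCompact F) (hx : IsMaximizer F w x)
    (huniq : ∀ y, IsMaximizer F w y → y = x) (c : ℝ × ℝ) {ε : ℝ} (hε : 0 < ε) :
    ∀ᶠ t : ℝ in atTop, gapFn F x (t • w - c) ≤ ε := by
  have hne : F.Nonempty := ⟨x, hx.1⟩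
  have hcont : Continuous fun n => pairing c x - pairing c n :=
    continuous_const.sub (continuous_pairing_right c)
  have hK : IsCompact (F ∩ {n | ε ≤ pairing c x - pairing c n}) :=
    hF.inter_right (isClosed_le continuous_const hcont)
  -- Where the `c` term costs at least `ε`, uniqueness and compactness give a loss of at least `δ`
  -- in direction `w`, which a large `t` turns into a dominating term.
  obtain ⟨δ, hδ, hδK⟩ := hK.exists_forall_le' (f := fun n => pairing w x - pairing w n) (a := 0)
    (continuous_const.sub (continuous_pairing_right w)).continuousOn (by
      rintro n ⟨hn, hn'⟩
      rcases (hx.2 n hn).lt_or_eq with h | h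
      · linarith
      · have : n = x := huniq n ⟨hn, fun y hy => (hx.2 y hy).trans h.ge⟩
        subst this
        have : ε ≤ 0 := by simpa using hn'
        linarith)
  obtain ⟨B, hB⟩ := (hF.image hcont).bddAbove
  filter_upwards [eventually_ge_atTop (B / δ), eventually_ge_atTop 0] with t ht ht0
  refine gapFn_le hne fun n hn => ?_
  rw [pairing_sub, pairing_sub, pairing_smul, pairing_smul]
  by_cases hn' : ε ≤ pairing c x - pairing c n
  · have h1 : B ≤ t * δ := (div_le_iff₀ hδ).1 ht
    have h2 := mul_le_mul_of_nonneg_left (hδK n ⟨hn, hn'⟩) ht0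
    have h3 : pairing c x - pairing c n ≤ B := hB (mem_image_of_mem _ hn)
    linarith
  · have h2 := mul_le_mul_of_nonneg_left (hx.2 n hn) ht0
    push Not at hn'
    linarith

theorem IsMaximizer.parallel_of_not_isKink {u : ℝ × ℝ} (hk : ¬ IsKink F x)
    (hx : IsMaximizer F w x) (hu : IsMaximizer F u x) : u.1 * w.2 = u.2 * w.1 := by
  by_contra h
  exact hk ⟨u, w, hu, hx, h⟩

/-- At an exposed point that is not a kink, the normals lie on a single ray. -/
theorem gapFn_pos_of_not_isKink (hF : IsCompact F) (hx : IsMaximizer F w x)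
    (huniq : ∀ y, IsMaximizer F w y → y = x) (hk : ¬ IsKink F x) (hw : w.1 * w.2 < 0)
    {u : ℝ × ℝ} (hu0 : u ≠ 0) (hu : u.1 * w.1 ≤ 0 ∨ u.2 * w.2 ≤ 0) : 0 < gapFn F x u := by
  by_contra! hgap
  have hmu := isMaximizer_of_gapFn_le_zero hF hx.1 hgap
  have hpar := hx.parallel_of_not_isKink hk hmu
  have hw1 : w.1 ≠ 0 := fun h => by simp [h] at hw
  have hw2 : w.2 ≠ 0 := fun h => by simp [h] at hw
  set s : ℝ := u.1 / w.1 with hs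
  have h1 : u.1 = s * w.1 := (div_mul_cancel₀ _ hw1).symm
  have h2 : u.2 = s * w.2 := by
    rw [h1] at hpar
    exact mul_right_cancel₀ hw1 (by linarith)
  have hs0 : s < 0 := by
    refine lt_of_le_of_ne ?_ fun h => hu0 (Prod.ext (by simp [h1, h]) (by simp [h2, h]))
    rcases hu with hu | hu
    · rw [h1, mul_assoc] at hu
      exact nonpos_of_mul_nonpos_left hu (mul_self_pos.2 hw1)
    · rw [h2, mul_assoc] at hu
      exact nonpos_of_mul_nonpos_left hu (mul_self_pos.2 hw2)
  -- With `s < 0` both `w` and a negative multiple of it are normals, so `pairing w` is constant on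
  -- `F`. Uniqueness then collapses `F` to a point, which is a kink.
  have hall : ∀ n ∈ F, n = x := fun n hn => by
    refine huniq n ⟨hn, fun y hy => (hx.2 y hy).trans ?_⟩
    have := hmu.2 n hn
    simp only [pairing, h1, h2] at this ⊢
    exact (mul_le_mul_left_of_neg hs0).1 (by linarith)
  exact hk ⟨(1, 0), (0, 1), ⟨hx.1, fun y hy => by rw [hall y hy]⟩,
    ⟨hx.1, fun y hy => by rw [hall y hy]⟩, by norm_num⟩

theorem isClosed_setOf_mul_le (w : ℝ × ℝ) (a : ℝ) :
    IsClosed {u : ℝ × ℝ | u.1 * w.1 ≤ a ∨ u.2 * w.2 ≤ a} := by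
  rw [ofPred_or]
  exact (isClosed_le (by fun_prop) continuous_const).union
    (isClosed_le (by fun_prop) continuous_const)

/-- At an exposed point that is not a kink, prices with a small gap for two groups whose
costs differ in a direction not parallel to the normal lie far out in its direction. -/
theorem exists_gap_forces_far (hF : IsCompact F) (hx : IsMaximizer F w x)
    (huniq : ∀ y, IsMaximizer F w y → y = x) (hk : ¬ IsKink F x) (hw : w.1 * w.2 < 0)
    {c d : ℝ × ℝ} (hcd : w.1 * (c.2 - d.2) ≠ w.2 * (c.1 - d.1)) :
    ∃ ε > 0, ∀ p : ℝ × ℝ, gapFn F x (p - c) ≤ ε → gapFn F x (p - d) ≤ ε →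
      1 < p.1 * w.1 ∧ 1 < p.2 * w.2 := by
  have hne : F.Nonempty := ⟨x, hx.1⟩
  have hw1 : 0 < w.1 * w.1 := mul_self_pos.2 fun h => by simp [h] at hw
  have hw2 : 0 < w.2 * w.2 := mul_self_pos.2 fun h => by simp [h] at hw
  have hgc : Continuous (gapFn F x) := continuous_gapFn hF x
  have hKclosed : IsClosed {u : ℝ × ℝ | u.1 * w.1 ≤ 0 ∨ u.2 * w.2 ≤ 0} :=
    isClosed_setOf_mul_le w 0
  have hK : IsCompact (Metric.sphere (0 : ℝ × ℝ) 1 ∩ {u | u.1 * w.1 ≤ 0 ∨ u.2 * w.2 ≤ 0}) :=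
    (isCompact_sphere _ _).inter_right hKclosed
  -- Outside the open quadrant of `w` the gap is positive on the unit sphere; homogeneity turns its
  -- minimum into linear growth there.
  obtain ⟨δ, hδ, hδK⟩ := hK.exists_forall_le' (f := gapFn F x) (a := 0) hgc.continuousOn (by
    rintro u ⟨hu1, hu⟩
    refine gapFn_pos_of_not_isKink hF hx huniq hk hw ?_ hu
    rintro rfl
    simp at hu1)
  have hcone : ∀ u : ℝ × ℝ, (u.1 * w.1 ≤ 0 ∨ u.2 * w.2 ≤ 0) → ‖u‖ * δ ≤ gapFn F x u := by
    intro u hu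
    rcases eq_or_ne u 0 with rfl | hu0
    · simpa using gapFn_nonneg hF hx.1 0
    have hn : 0 < ‖u‖ := norm_pos_iff.2 hu0
    have h1 : δ ≤ gapFn F x (‖u‖⁻¹ • u) := by
      refine hδK _ ⟨by simp [norm_smul, hn.ne'], ?_⟩
      have hi := inv_nonneg.2 hn.le
      simp only [mem_ofPred_eq, Prod.smul_fst, Prod.smul_snd, smul_eq_mul, mul_assoc]
      exact hu.imp (mul_nonpos_of_nonneg_of_nonpos hi) (mul_nonpos_of_nonneg_of_nonpos hi)
    have h2 := gapFn_smul_le (x := x) hF hne (inv_nonneg.2 hn.le) u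
    have h3 := mul_le_mul_of_nonneg_left (h1.trans h2) hn.le
    rwa [mul_inv_cancel_left₀ hn.ne'] at h3
  -- `τ` puts `e = c + τ • w` beyond level `1` in both coordinates, so `p - e` leaves the open
  -- quadrant of `w` for each `p` violating the conclusion.
  obtain ⟨τ, hτ0, hτ1, hτ2⟩ : ∃ τ : ℝ, 0 ≤ τ ∧ 1 - c.1 * w.1 ≤ τ * (w.1 * w.1) ∧
      1 - c.2 * w.2 ≤ τ * (w.2 * w.2) := by
    refine ⟨max 0 (max ((1 - c.1 * w.1) / (w.1 * w.1)) ((1 - c.2 * w.2) / (w.2 * w.2))),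
      le_max_left _ _, ?_, ?_⟩
    · rw [← div_le_iff₀ hw1]
      exact (le_max_left _ _).trans (le_max_right _ _)
    · rw [← div_le_iff₀ hw2]
      exact (le_max_right _ _).trans (le_max_right _ _)
  set C : Set (ℝ × ℝ) := {p | p.1 * w.1 ≤ 1 ∨ p.2 * w.2 ≤ 1} with hC
  have hCclosed : IsClosed C := isClosed_setOf_mul_le w 1
  set e : ℝ × ℝ := c + τ • w with he
  set B : ℝ := gapFn F x (τ • -w) with hB
  have hfar : ∀ p ∈ C, (‖p‖ - ‖e‖) * δ - B ≤ gapFn F x (p - c) := by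
    intro p hp
    have hu : (p - e).1 * w.1 ≤ 0 ∨ (p - e).2 * w.2 ≤ 0 := by
      simp only [he, Prod.fst_sub, Prod.snd_sub, Prod.fst_add, Prod.snd_add, Prod.smul_fst,
        Prod.smul_snd, smul_eq_mul]
      rcases hp with hp | hp
      · left; linarith
      · right; linarith
    have h1 := hcone _ hu
    have h2 := gapFn_add_le (x := x) hF hne (p - c) (τ • -w)
    have h3 : p - c + τ • -w = p - e := by rw [he, smul_neg]; abel
    rw [h3] at h2
    have h4 := mul_le_mul_of_nonneg_right (norm_sub_norm_le p e) hδ.le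
    linarith
  -- On a bounded part of `C` the two gaps cannot vanish together: `p - c` and `p - d` would both be
  -- parallel to `w`, hence `c - d` too. The radius makes the first gap exceed `2` outside the ball.
  obtain ⟨ε, hε, hεC⟩ := ((isCompact_closedBall (0 : ℝ × ℝ) ((2 + B) / δ + ‖e‖)).inter_right
      hCclosed).exists_forall_le' (f := fun p => max (gapFn F x (p - c)) (gapFn F x (p - d)))
      (a := 0) (by fun_prop) (by
    rintro p -
    by_contra! h
    have hc' := hx.parallel_of_not_isKink hk
      (isMaximizer_of_gapFn_le_zero hF hx.1 ((le_max_left _ _).trans h))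
    have hd' := hx.parallel_of_not_isKink hk
      (isMaximizer_of_gapFn_le_zero hF hx.1 ((le_max_right _ _).trans h))
    simp only [Prod.fst_sub, Prod.snd_sub] at hc' hd'
    exact hcd (by linarith))
  refine ⟨min 1 (ε / 2), lt_min one_pos (half_pos hε), fun p hpc hpd => ?_⟩
  by_contra hcon
  have hpC : p ∈ C := by
    simp only [hC, mem_ofPred_eq]
    by_contra! h
    exact hcon h
  by_cases hball : ‖p‖ ≤ (2 + B) / δ + ‖e‖
  · have h1 := hεC p ⟨by simpa using hball, hpC⟩
    have h2 := max_le hpc hpd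
    linarith [min_le_right 1 (ε / 2)]
  · push Not at hball
    have h1 : (2 + B) / δ * δ < (‖p‖ - ‖e‖) * δ :=
      mul_lt_mul_of_pos_right (by linarith) hδ
    rw [div_mul_cancel₀ _ hδ.ne'] at h1
    linarith [hfar p hpC, min_le_left 1 (ε / 2)]

end Smooth

/-! ### Existence of non-kinks by a countability argument. -/

section ExistsSmooth

variable {F : Set (ℝ × ℝ)}

/-- Maximizers of the weights `(-s, 1)` depend continuously on `s` if they are unique. -/
theorem continuous_of_isMaximizer (hF : IsCompact F) (X : ℝ → ℝ × ℝ)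
    (hX : ∀ s, IsMaximizer F (-s, 1) (X s))
    (huniq : ∀ s y, IsMaximizer F (-s, 1) y → y = X s) : Continuous X := by
  refine continuous_iff_continuousAt.2 fun s => ?_
  refine hF.tendsto_nhds_of_unique_mapClusterPt (Eventually.of_forall fun t => (hX t).1) ?_
  intro y hy hcl
  refine huniq s y ⟨hy, fun z hz => ?_⟩
  by_contra! hlt
  have hopen : IsOpen {v : ℝ × (ℝ × ℝ) | pairing (-v.1, 1) v.2 < pairing (-v.1, 1) z} := by
    refine isOpen_lt ?_ ?_ <;> (unfold pairing; fun_prop)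
  have hmem : {v : ℝ × (ℝ × ℝ) | pairing (-v.1, 1) v.2 < pairing (-v.1, 1) z} ∈ 𝓝 (s, y) :=
    hopen.mem_nhds hlt
  rw [nhds_prod_eq] at hmem
  obtain ⟨U, hU, V, hV, hUV⟩ := Filter.mem_prod_iff.1 hmem
  obtain ⟨t, htV, htU⟩ := ((mapClusterPt_iff_frequently.1 hcl V hV).and_eventually hU).exists
  have h1 : pairing (-t, 1) (X t) < pairing (-t, 1) z := hUV (mk_mem_prod htU htV)
  exact absurd ((hX t).2 z hz) (not_le.2 h1)

/-- Kinks are the maximizers of a nondegenerate interval of weights. -/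
theorem exists_rat_isMaximizer_of_isKink {x : ℝ × ℝ} {s : ℝ} (hx : IsMaximizer F (-s, 1) x)
    (hk : IsKink F x) : ∃ q : ℚ, IsMaximizer F (-(q : ℝ), 1) x := by
  obtain ⟨v, hv, hpar⟩ : ∃ v : ℝ × ℝ, IsMaximizer F v x ∧ v.1 + s * v.2 ≠ 0 := by
    obtain ⟨u, v, hu, hv, huv⟩ := hk
    by_contra! h
    have h1 := h u hu
    have h2 := h v hv
    refine huv ?_
    rw [eq_neg_of_add_eq_zero_left h1, eq_neg_of_add_eq_zero_left h2]; ring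
  obtain ⟨r, hrs, hr⟩ : ∃ r : ℝ, r ≠ s ∧ IsMaximizer F (-r, 1) x := by
    -- This size keeps the second component of `(-s, 1) + η • v` at least `1 / 2`, so the sum
    -- rescales to some `(-r, 1)`.
    set η : ℝ := 1 / (2 * (1 + |v.2|)) with hη
    have hpos : 0 < 1 + |v.2| := by positivity
    have hη0 : 0 < η := by positivity
    have hηv : η * |v.2| ≤ 1 / 2 := by
      rw [hη, div_mul_eq_mul_div, div_le_div_iff₀ (by positivity) (by norm_num)]
      linarith [abs_nonneg v.2]
    have hd : 0 < 1 + η * v.2 := by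
      nlinarith [neg_abs_le v.2]
    have hm := (hx.add (hv.smul hη0.le)).smul (inv_nonneg.2 hd.le)
    refine ⟨(s - η * v.1) / (1 + η * v.2), fun h => hpar ?_, ?_⟩
    · rw [div_eq_iff hd.ne'] at h
      have : η * (v.1 + s * v.2) = 0 := by linarith
      exact (mul_eq_zero.1 this).resolve_left hη0.ne'
    · convert hm using 1
      ext
      · simp only [Prod.smul_fst, Prod.fst_add, smul_eq_mul]; field_simp; ring
      · simp only [Prod.smul_snd, Prod.snd_add, smul_eq_mul]; field_simp
  have key : ∀ a b : ℝ, a < b → IsMaximizer F (-a, 1) x → IsMaximizer F (-b, 1) x →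
      ∃ q : ℚ, IsMaximizer F (-(q : ℝ), 1) x := by
    intro a b hab ha hb
    obtain ⟨q, haq, hqb⟩ := exists_rat_btwn hab
    refine ⟨q, ?_⟩
    have hd : 0 < b - a := sub_pos.2 hab
    have hm := (ha.smul (t := (b - q) / (b - a)) (div_nonneg (by linarith) hd.le)).add
      (hb.smul (t := (q - a) / (b - a)) (div_nonneg (by linarith) hd.le))
    convert hm using 1
    ext
    · simp only [Prod.smul_fst, Prod.fst_add, smul_eq_mul]; field_simp; ring
    · simp only [Prod.smul_snd, Prod.snd_add, smul_eq_mul]; field_simp; ring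
  rcases lt_or_gt_of_ne hrs with h | h
  · exact key r s h hr hx
  · exact key s r h hx hr

/-- If the largest feasible value of the second task is not attained without the first, the
upward-sloping segment contains points that are not kinks. -/
theorem exists_not_isKink (hF : IsCompact F) (hs : StrictlyConvexFrontier F)
    (hpos : ∀ n ∈ F, 0 ≤ n) (h0 : (0 : ℝ × ℝ) ∈ F) {m : ℝ × ℝ} (hm : m ∈ F)
    (hmax : ∀ n ∈ F, n.1 = 0 → n.2 < m.2) (s₀ : ℝ) :
    ∃ s x, 0 < s ∧ s ≠ s₀ ∧ IsMaximizer F (-s, 1) x ∧ ¬ IsKink F x := by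
  choose X hX using fun s : ℝ => exists_isMaximizer hF ⟨0, h0⟩ (-s, 1)
  have huniq : ∀ s y, IsMaximizer F (-s, 1) y → y = X s := fun s y hy =>
    (hX s).unique hs (fun h => absurd h.2 (by norm_num)) hy
  have hc := continuous_of_isMaximizer hF X hX huniq
  by_contra! hall
  have hX0 : 0 < (X 0).1 := by
    refine lt_of_le_of_ne (hpos _ (hX 0).1).1 fun h => ?_
    have h1 := hmax _ (hX 0).1 h.symm
    have h2 := (hX 0).2 m hm
    simp only [pairing, neg_zero, zero_mul, one_mul, zero_add] at h2
    linarith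
  obtain ⟨B, hB⟩ := (hF.image continuous_snd).bddAbove
  have hB0 : 0 ≤ B := by simpa using hB (mem_image_of_mem _ h0)
  -- Comparison with the origin gives `S * (X S).1 ≤ B`, so this choice forces `(X S).1 < (X 0).1`.
  set S : ℝ := (B + 1) / (X 0).1 with hS
  have hS0 : 0 < S := by positivity
  have hXS : (X S).1 < (X 0).1 := by
    have h1 := (hX S).2 0 h0
    have h2 : (X S).2 ≤ B := hB (mem_image_of_mem _ (hX S).1)
    simp only [pairing, Prod.fst_zero, Prod.snd_zero, mul_zero, add_zero, one_mul] at h1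
    have h3 : S * (X 0).1 = B + 1 := div_mul_cancel₀ _ hX0.ne'
    exact lt_of_mul_lt_mul_left (by linarith) hS0.le
  have hIVT : Icc (X S).1 (X 0).1 ⊆ (fun s => (X s).1) '' Icc 0 S :=
    intermediate_value_Icc' hS0.le (continuous_fst.comp hc).continuousOn
  -- If all other slopes gave kinks, each value in the interval would come from a rational slope,
  -- `0` or `s₀`.
  have hcount : ((fun s => (X s).1) '' (range ((↑) : ℚ → ℝ) ∪ {0, s₀})).Countable :=
    ((countable_range _).union (by simp)).image _
  refine absurd (Cardinal.Real.Icc_countable_iff.1 (hcount.mono (hIVT.trans ?_))) (not_le.2 hXS)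
  rintro _ ⟨s, ⟨hs0, -⟩, rfl⟩
  rcases hs0.eq_or_lt with rfl | hs0
  · exact mem_image_of_mem _ (by simp)
  rcases eq_or_ne s s₀ with rfl | hne
  · exact mem_image_of_mem _ (by simp)
  obtain ⟨q, hq⟩ := exists_rat_isMaximizer_of_isKink (hX s) (hall s _ hs0 hne (hX s))
  exact ⟨q, Or.inl ⟨q, rfl⟩, congrArg Prod.fst (huniq q _ hq).symm⟩

end ExistsSmooth

/-! ### Exchange of the two tasks. -/

section Swap

variable {F : Set (ℝ × ℝ)} {x w : ℝ × ℝ}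

theorem pairing_swap (w n : ℝ × ℝ) : pairing w.swap n.swap = pairing w n := by
  simp [pairing, add_comm]

theorem IsMaximizer.swap (h : IsMaximizer F w x) :
    IsMaximizer (Prod.swap '' F) w.swap x.swap :=
  ⟨mem_image_of_mem _ h.1, by
    rintro _ ⟨y, hy, rfl⟩
    simpa only [pairing_swap] using h.2 y hy⟩

theorem swap_image_swap_image (F : Set (ℝ × ℝ)) : Prod.swap '' (Prod.swap '' F) = F := by
  simp [image_image]

theorem IsMaximizer.of_swap (h : IsMaximizer (Prod.swap '' F) w x) :
    IsMaximizer F w.swap x.swap := by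
  simpa only [swap_image_swap_image] using h.swap

theorem IsKink.swap (h : IsKink F x) : IsKink (Prod.swap '' F) x.swap := by
  obtain ⟨u, v, hu, hv, huv⟩ := h
  exact ⟨_, _, hu.swap, hv.swap, huv.symm⟩

theorem gapFn_swap (F : Set (ℝ × ℝ)) (x w : ℝ × ℝ) :
    gapFn (Prod.swap '' F) x.swap w.swap = gapFn F x w := by
  simp only [gapFn, supportFn, pairing_swap, image_image]

theorem swap_mem_frontierSet (h : x ∈ frontierSet (Prod.swap '' F)) : x.swap ∈ frontierSet F := by
  obtain ⟨w, hw, hx⟩ := h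
  exact ⟨w.swap, fun h => hw ⟨h.2, h.1⟩, hx.of_swap⟩

theorem StrictlyConvexFrontier.swap (hs : StrictlyConvexFrontier F) :
    StrictlyConvexFrontier (Prod.swap '' F) := by
  intro x hx y hy hxy z hz
  have h1 := hs _ (swap_mem_frontierSet hx) _ (swap_mem_frontierSet hy)
    (Prod.swap_injective.ne hxy)
  obtain ⟨a, b, ha, hb, hab, rfl⟩ := hz
  have h2 : a • x.swap + b • y.swap ∈ interior F := h1 ⟨a, b, ha, hb, hab, rfl⟩
  have h3 : Prod.swap '' interior F ⊆ interior (Prod.swap '' F) :=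
    (Homeomorph.prodComm ℝ ℝ).isOpenMap.image_interior_subset F
  exact h3 ⟨_, h2, rfl⟩

end Swap

/-! ### The dual program and the equilibrium set. -/

section Dual

variable {J : ℕ} {G : Fin J → WorkerGroup} {F : Set (ℝ × ℝ)}

theorem zero_le_iInf_iSup_iff (X : ℝ → Set (ℝ × ℝ)) (f : ℝ × ℝ → ℝ) :
    (0 : EReal) ≤ ⨅ (ε : ℝ) (_ : 0 < ε), ⨆ p ∈ X ε, ((f p : ℝ) : EReal) ↔
      ∀ ε > 0, ∀ δ > 0, ∃ p ∈ X ε, -δ < f p := by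
  rw [le_iInf₂_iff]
  refine forall₂_congr fun ε _ => ⟨fun h δ hδ => ?_, fun h => ?_⟩
  · have h1 : ((-δ : ℝ) : EReal) < ⨆ p ∈ X ε, ((f p : ℝ) : EReal) :=
      lt_of_lt_of_le (by exact_mod_cast neg_lt_zero.2 hδ) h
    obtain ⟨p, hp⟩ := lt_iSup_iff.1 h1
    obtain ⟨hpX, hp⟩ := lt_iSup_iff.1 hp
    exact ⟨p, hpX, by exact_mod_cast hp⟩
  · refine le_of_forall_lt fun c hc => ?_
    obtain ⟨r, hcr, hr⟩ := EReal.lt_iff_exists_real_btwn.1 hc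
    have hr' : r < 0 := by exact_mod_cast hr
    obtain ⟨p, hp, hrp⟩ := h (-r) (neg_pos.2 hr')
    rw [neg_neg] at hrp
    refine hcr.trans (lt_of_lt_of_le ?_ (le_iSup₂ (f := fun p _ => ((f p : ℝ) : EReal)) p hp))
    exact_mod_cast hrp

theorem zero_le_maxPriceA_iff (G : Fin J → WorkerGroup) (l : ℝ × ℝ) :
    0 ≤ maxPriceA G l ↔ ∀ ε > 0, ∀ δ > 0, ∃ p ∈ approxDualSolutions G ε l, -δ < p.1 :=
  zero_le_iInf_iSup_iff (fun ε => approxDualSolutions G ε l) Prod.fst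

theorem zero_le_maxPriceB_iff (G : Fin J → WorkerGroup) (l : ℝ × ℝ) :
    0 ≤ maxPriceB G l ↔ ∀ ε > 0, ∀ δ > 0, ∃ p ∈ approxDualSolutions G ε l, -δ < p.2 :=
  zero_le_iInf_iSup_iff (fun ε => approxDualSolutions G ε l) Prod.snd

/-- The dual objective at a feasible allocation falls short of the cost of the uniform assignment
by the sum of the groups' gaps. -/
theorem dualObjective_smul (hG : ∀ j, (G j).feasibleSet = F) (x p : ℝ × ℝ) :
    dualObjective G ((J : ℝ) • x) p
      = ∑ j, pairing (G j).cost x - ∑ j, gapFn F x (p - (G j).cost) := by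
  have hsup : ∀ j w, (G j).support w = supportFn F w := fun j w => by
    rw [WorkerGroup.support, hG j, supportFn]
  simp only [dualObjective, hsup, gapFn, pairing_sub, Finset.sum_sub_distrib, pairing_smul_right,
    Finset.sum_const, Finset.card_univ, Fintype.card_fin, nsmul_eq_mul]
  ring

theorem approxDualSolutions_nonempty (hF : IsCompact F) (hG : ∀ j, (G j).feasibleSet = F)
    {x : ℝ × ℝ} (hx : x ∈ F) {ε : ℝ} (hε : 0 < ε) :
    (approxDualSolutions G ε ((J : ℝ) • x)).Nonempty := by
  have hb : BddAbove (range (dualObjective G ((J : ℝ) • x))) := by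
    refine ⟨∑ j, pairing (G j).cost x, ?_⟩
    rintro _ ⟨p, rfl⟩
    rw [dualObjective_smul hG]
    linarith [Finset.sum_nonneg fun j (_ : j ∈ Finset.univ) =>
      gapFn_nonneg hF hx (p - (G j).cost)]
  obtain ⟨p, hp⟩ := exists_lt_of_lt_ciSup
    (sub_lt_self (⨆ p, dualObjective G ((J : ℝ) • x) p) hε)
  exact ⟨p, fun q => by linarith [le_ciSup hb q]⟩

theorem zero_le_maxPriceA_of_forall_exists (hF : IsCompact F) (hG : ∀ j, (G j).feasibleSet = F)
    {x : ℝ × ℝ} (hx : x ∈ F)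
    (h : ∀ p : ℝ × ℝ, ∃ q : ℝ × ℝ, 0 ≤ q.1 ∧
      ∀ j, gapFn F x (q - (G j).cost) ≤ gapFn F x (p - (G j).cost)) :
    0 ≤ maxPriceA G ((J : ℝ) • x) := by
  refine (zero_le_maxPriceA_iff _ _).2 fun ε hε δ hδ => ?_
  obtain ⟨p, hp⟩ := approxDualSolutions_nonempty hF hG hx hε
  obtain ⟨q, hq, hqp⟩ := h p
  refine ⟨q, fun r => (hp r).trans ?_, by linarith⟩
  rw [dualObjective_smul hG, dualObjective_smul hG]
  linarith [Finset.sum_le_sum fun j (_ : j ∈ Finset.univ) => hqp j]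

theorem zero_le_maxPriceB_of_forall_exists (hF : IsCompact F) (hG : ∀ j, (G j).feasibleSet = F)
    {x : ℝ × ℝ} (hx : x ∈ F)
    (h : ∀ p : ℝ × ℝ, ∃ q : ℝ × ℝ, 0 ≤ q.1 ∧
      ∀ j, gapFn (Prod.swap '' F) x.swap (q - (G j).cost.swap)
        ≤ gapFn (Prod.swap '' F) x.swap (p - (G j).cost.swap)) :
    0 ≤ maxPriceB G ((J : ℝ) • x) := by
  refine (zero_le_maxPriceB_iff _ _).2 fun ε hε δ hδ => ?_
  obtain ⟨p, hp⟩ := approxDualSolutions_nonempty hF hG hx hε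
  obtain ⟨q, hq, hqp⟩ := h p.swap
  have hqp' : ∀ j, gapFn F x (q.swap - (G j).cost) ≤ gapFn F x (p - (G j).cost) := fun j => by
    rw [← gapFn_swap F x (p - _), ← gapFn_swap F x (q.swap - _)]
    exact hqp j
  refine ⟨q.swap, fun r => (hp r).trans ?_, by simpa using by linarith⟩
  rw [dualObjective_smul hG, dualObjective_smul hG]
  linarith [Finset.sum_le_sum fun j (_ : j ∈ Finset.univ) => hqp' j]

theorem mem_equilibriumSet_of_downward (hF : IsCompact F) (hG : ∀ j, (G j).feasibleSet = F)
    {x w : ℝ × ℝ} (hx : IsMaximizer F w x) (hw : 0 ≤ w) (hw0 : w ≠ 0) :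
    x ∈ equilibriumSet G F :=
  ⟨hx.1, zero_le_maxPriceA_of_forall_exists hF hG hx.1
      (hx.exists_price_fst_nonneg hF hw hw0 _ fun j => (G j).costA_pos),
    zero_le_maxPriceB_of_forall_exists hF hG hx.1
      (hx.swap.exists_price_fst_nonneg (hF.image continuous_swap) ⟨hw.2, hw.1⟩
        (fun h => hw0 (Prod.swap_injective h)) _ fun j => (G j).costB_pos)⟩

theorem equilibriumSet_eq_of_dominated (hF : IsCompact F) (hG : ∀ j, (G j).feasibleSet = F)
    (hpos : ∀ n ∈ F, 0 ≤ n) (h0 : (0 : ℝ × ℝ) ∈ F)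
    (hA : ∀ n ∈ F, ∃ m, (m, (0 : ℝ)) ∈ F ∧ n.1 ≤ m)
    (hB : ∀ n ∈ F, ∃ m, ((0 : ℝ), m) ∈ F ∧ n.2 ≤ m) : equilibriumSet G F = F := by
  refine Subset.antisymm (fun x hx => hx.1) fun x hx => ⟨hx, ?_, ?_⟩
  · exact zero_le_maxPriceA_of_forall_exists hF hG hx
      (exists_price_fst_nonneg_of_dominated hF hx hpos h0 hB _ fun j => (G j).costA_pos)
  · refine zero_le_maxPriceB_of_forall_exists hF hG hx
      (exists_price_fst_nonneg_of_dominated (hF.image continuous_swap) (mem_image_of_mem _ hx)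
        ?_ ⟨0, h0, rfl⟩ ?_ _ fun j => (G j).costB_pos)
    · rintro _ ⟨n, hn, rfl⟩
      exact ⟨(hpos n hn).2, (hpos n hn).1⟩
    · rintro _ ⟨n, hn, rfl⟩
      obtain ⟨m, hm, hnm⟩ := hA n hn
      exact ⟨m, ⟨_, hm, rfl⟩, hnm⟩

theorem not_mem_equilibriumSet_of_upward (hF : IsCompact F) (hG : ∀ j, (G j).feasibleSet = F)
    (hs : StrictlyConvexFrontier F) {x w : ℝ × ℝ} (hx : IsMaximizer F w x) (hw : w.1 * w.2 < 0)
    (hk : ¬ IsKink F x) {i j : Fin J}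
    (hij : w.1 * ((G i).costB - (G j).costB) ≠ w.2 * ((G i).costA - (G j).costA)) :
    x ∉ equilibriumSet G F := by
  rintro ⟨-, hA, hB⟩
  have huniq : ∀ y, IsMaximizer F w y → y = x := fun y hy => by
    refine hx.unique hs (fun h => ?_) hy
    exact absurd (mul_nonneg_of_nonpos_of_nonpos h.1 h.2) (not_le.2 hw)
  obtain ⟨ε, hε, hfar⟩ := exists_gap_forces_far hF hx huniq hk hw
    (c := (G i).cost) (d := (G j).cost) hij
  have hJ : 0 < (J : ℝ) := by exact_mod_cast i.pos
  -- Prices far along the normal bring the total gap below `ε / 2`, so any `ε / 2`-solution has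
  -- every gap at most `ε`.
  obtain ⟨t, ht⟩ := (eventually_all.2 fun k : Fin J =>
    hx.eventually_gapFn_le hF huniq (G k).cost (ε := ε / 2 / J) (by positivity)).exists
  have hfar' : ∀ p ∈ approxDualSolutions G (ε / 2) ((J : ℝ) • x),
      1 < p.1 * w.1 ∧ 1 < p.2 * w.2 := by
    intro p hp
    have h1 := hp (t • w)
    rw [dualObjective_smul hG, dualObjective_smul hG] at h1
    have h2 : ∑ k, gapFn F x (t • w - (G k).cost) ≤ ε / 2 := by
      refine (Finset.sum_le_sum fun k _ => ht k).trans_eq ?_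
      simp only [Finset.sum_const, Finset.card_univ, Fintype.card_fin, nsmul_eq_mul]
      field_simp
    have h3 : ∀ k, gapFn F x (p - (G k).cost) ≤ ε := fun k => by
      have := Finset.single_le_sum (f := fun k => gapFn F x (p - (G k).cost))
        (fun k _ => gapFn_nonneg hF hx.1 _) (Finset.mem_univ k)
      linarith
    exact hfar p (h3 i) (h3 j)
  have key : ∀ v : ℝ, v < 0 → ∀ y : ℝ, 1 < y * v → y ≤ -(-v)⁻¹ := by
    intro v hv y hy
    have hv' : 0 < -v := neg_pos.2 hv
    rw [le_neg, inv_eq_one_div, div_le_iff₀ hv']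
    linarith
  rcases mul_neg_iff.1 hw with ⟨-, h2⟩ | ⟨h1, -⟩
  · obtain ⟨p, hp, hp2⟩ := (zero_le_maxPriceB_iff _ _).1 hB (ε / 2) (half_pos hε) (-w.2)⁻¹
      (inv_pos.2 (neg_pos.2 h2))
    linarith [key _ h2 _ (hfar' p hp).2]
  · obtain ⟨p, hp, hp1⟩ := (zero_le_maxPriceA_iff _ _).1 hA (ε / 2) (half_pos hε) (-w.1)⁻¹
      (inv_pos.2 (neg_pos.2 h1))
    linarith [key _ h1 _ (hfar' p hp).1]

/-- Approximately optimal prices for a task stay nonnegative when its quantity increases. -/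
theorem exists_approx_of_shift {l l' : ℝ × ℝ} (f : ℝ × ℝ → ℝ) {Δ : ℝ} (hΔ : 0 ≤ Δ)
    (hl : ∀ q, dualObjective G l' q = dualObjective G l q + f q * Δ)
    (hne : ∀ ε > 0, (approxDualSolutions G ε l').Nonempty)
    (h : ∀ ε > 0, ∀ δ > 0, ∃ p ∈ approxDualSolutions G ε l, -δ < f p) :
    ∀ ε > 0, ∀ δ > 0, ∃ p ∈ approxDualSolutions G ε l', -δ < f p := by
  intro ε hε δ hδ
  obtain ⟨p, hp, hpδ⟩ := h (ε / 2) (half_pos hε) δ hδ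
  obtain ⟨q, hq⟩ := hne (ε / 2) (half_pos hε)
  rcases le_or_gt (f p) (f q) with hpq | hpq
  · exact ⟨q, fun r => by linarith [hq r], by linarith⟩
  · refine ⟨p, fun r => ?_, hpδ⟩
    have h1 := hq r
    have h2 := hp q
    have h3 := mul_le_mul_of_nonneg_right hpq.le hΔ
    rw [hl r, hl q] at h1
    rw [hl r, hl p]
    linarith

/-- Adding the two optimality inequalities cancels the objective and leaves `(f p' - f p) * Δ ≥ 0`.
-/
theorem price_le_of_shift {l l' : ℝ × ℝ} (f : ℝ × ℝ → ℝ) {Δ : ℝ} (hΔ : 0 < Δ)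
    (hl : ∀ q, dualObjective G l' q = dualObjective G l q + f q * Δ) {p p' : ℝ × ℝ}
    (hp : p ∈ dualSolutions G l) (hp' : p' ∈ dualSolutions G l') : f p ≤ f p' := by
  have h1 := hp p'
  have h2 := hp' p
  rw [hl, hl] at h2
  exact le_of_mul_le_mul_right (by linarith) hΔ

theorem approxDualSolutions_nonempty_of_div (hF : IsCompact F)
    (hG : ∀ j, (G j).feasibleSet = F) (hJ : 0 < J) {a b : ℝ} (h : (a / J, b / J) ∈ F) {ε : ℝ}
    (hε : 0 < ε) : (approxDualSolutions G ε (a, b)).Nonempty := by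
  have hJ' : (J : ℝ) ≠ 0 := by exact_mod_cast hJ.ne'
  have := approxDualSolutions_nonempty hF hG h hε
  rwa [Prod.smul_mk, smul_eq_mul, smul_eq_mul, mul_div_cancel₀ _ hJ', mul_div_cancel₀ _ hJ']
    at this

theorem maxPriceA_mono (hF : IsCompact F) (hG : ∀ j, (G j).feasibleSet = F) (hJ : 0 < J)
    {a a' b : ℝ} (haa : a ≤ a') (h : (a' / J, b / J) ∈ F) :
    (0 ≤ maxPriceA G (a, b) → 0 ≤ maxPriceA G (a', b)) ∧
      (a < a' → ∀ p ∈ dualSolutions G (a, b), 0 ≤ p.1 →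
        ∀ p' ∈ dualSolutions G (a', b), 0 ≤ p'.1) := by
  have hl : ∀ q : ℝ × ℝ, dualObjective G (a', b) q
      = dualObjective G (a, b) q + q.1 * (a' - a) := fun q => by
    simp only [dualObjective, pairing]; ring
  refine ⟨fun h1 => ?_, fun hlt p hp hp0 p' hp' =>
    hp0.trans (price_le_of_shift Prod.fst (sub_pos.2 hlt) hl hp hp')⟩
  rw [zero_le_maxPriceA_iff] at h1 ⊢
  exact exists_approx_of_shift Prod.fst (sub_nonneg.2 haa) hl
    (fun ε hε => approxDualSolutions_nonempty_of_div hF hG hJ h hε) h1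

theorem maxPriceB_mono (hF : IsCompact F) (hG : ∀ j, (G j).feasibleSet = F) (hJ : 0 < J)
    {a b b' : ℝ} (hbb : b ≤ b') (h : (a / J, b' / J) ∈ F) :
    (0 ≤ maxPriceB G (a, b) → 0 ≤ maxPriceB G (a, b')) ∧
      (b < b' → ∀ p ∈ dualSolutions G (a, b), 0 ≤ p.2 →
        ∀ p' ∈ dualSolutions G (a, b'), 0 ≤ p'.2) := by
  have hl : ∀ q : ℝ × ℝ, dualObjective G (a, b') q
      = dualObjective G (a, b) q + q.2 * (b' - b) := fun q => by
    simp only [dualObjective, pairing]; ring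
  refine ⟨fun h1 => ?_, fun hlt p hp hp0 p' hp' =>
    hp0.trans (price_le_of_shift Prod.snd (sub_pos.2 hlt) hl hp hp')⟩
  rw [zero_le_maxPriceB_iff] at h1 ⊢
  exact exists_approx_of_shift Prod.snd (sub_nonneg.2 hbb) hl
    (fun ε hε => approxDualSolutions_nonempty_of_div hF hG hJ h hε) h1

/-- If every feasible allocation is an equilibrium, then the largest feasible value of the second
task is attained without the first one. -/
theorem exists_le_snd_of_equilibriumSet_eq (hF : IsCompact F) (hG : ∀ j, (G j).feasibleSet = F)
    (hs : StrictlyConvexFrontier F) (hpos : ∀ n ∈ F, 0 ≤ n) (h0 : (0 : ℝ × ℝ) ∈ F)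
    {i j : Fin J} (hij : (G i).costB ≠ (G j).costB) (heq : equilibriumSet G F = F)
    {m : ℝ × ℝ} (hm : m ∈ F) : ∃ n ∈ F, n.1 = 0 ∧ m.2 ≤ n.2 := by
  by_contra! hmax
  -- The excluded slope is the only one at which `(-s, 1)` is parallel to the cost difference of
  -- groups `i` and `j`.
  obtain ⟨s, x, hs0, hne, hx, hk⟩ := exists_not_isKink hF hs hpos h0 hm hmax
    (-(((G i).costA - (G j).costA) / ((G i).costB - (G j).costB)))
  refine not_mem_equilibriumSet_of_upward hF hG hs hx (by simpa using hs0) hk (i := i) (j := j)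
    (fun h => hne ?_) (heq.ge hx.1)
  rw [← neg_div, eq_div_iff (sub_ne_zero.2 hij)]
  linarith

theorem exists_le_fst_of_equilibriumSet_eq (hF : IsCompact F) (hG : ∀ j, (G j).feasibleSet = F)
    (hs : StrictlyConvexFrontier F) (hpos : ∀ n ∈ F, 0 ≤ n) (h0 : (0 : ℝ × ℝ) ∈ F)
    {i j : Fin J} (hij : (G i).costA ≠ (G j).costA) (heq : equilibriumSet G F = F)
    {m : ℝ × ℝ} (hm : m ∈ F) : ∃ n ∈ F, n.2 = 0 ∧ m.1 ≤ n.1 := by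
  by_contra! hmax
  obtain ⟨s, x, hs0, hne, hx, hk⟩ := exists_not_isKink (hF.image continuous_swap) hs.swap
    (by rintro _ ⟨n, hn, rfl⟩; exact ⟨(hpos n hn).2, (hpos n hn).1⟩) ⟨0, h0, rfl⟩
    (mem_image_of_mem _ hm) (by rintro _ ⟨n, hn, rfl⟩; exact hmax n hn)
    (-(((G i).costB - (G j).costB) / ((G i).costA - (G j).costA)))
  refine not_mem_equilibriumSet_of_upward hF hG hs hx.of_swap (by simpa using hs0)
    (fun h => hk (by simpa using h.swap)) (i := i) (j := j)
    (fun h => hne ?_) (heq.ge hx.of_swap.1)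
  rw [← neg_div, eq_div_iff (sub_ne_zero.2 hij)]
  simp only [Prod.fst_swap, Prod.snd_swap] at h
  linarith

end Dual

/-! ### Selection of convergent monotone functions. -/

theorem tendsto_of_antitone_of_continuousAt {u : ℕ → ℝ → ℝ} (hu : ∀ k, Antitone (u k))
    {α : ℝ → ℝ} (hq : ∀ q : ℚ, Tendsto (fun k => u k q) atTop (𝓝 (α q))) {θ : ℝ}
    (hc : ContinuousAt α θ) : Tendsto (fun k => u k θ) atTop (𝓝 (α θ)) := by
  refine tendsto_order.2 ⟨fun c h => ?_, fun c h => ?_⟩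
  · obtain ⟨ε, hε, hball⟩ := Metric.eventually_nhds_iff.1 (hc.eventually (lt_mem_nhds h))
    obtain ⟨q, h1, h2⟩ := exists_rat_btwn (lt_add_of_pos_right θ hε)
    have hcq : c < α q := hball (by rw [Real.dist_eq, abs_lt]; constructor <;> linarith)
    filter_upwards [(hq q).eventually (lt_mem_nhds hcq)] with k hk
    exact hk.trans_le (hu k h1.le)
  · obtain ⟨ε, hε, hball⟩ := Metric.eventually_nhds_iff.1 (hc.eventually (gt_mem_nhds h))
    obtain ⟨q, h1, h2⟩ := exists_rat_btwn (sub_lt_self θ hε)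
    have hcq : α q < c := hball (by rw [Real.dist_eq, abs_lt]; constructor <;> linarith)
    filter_upwards [(hq q).eventually (gt_mem_nhds hcq)] with k hk
    exact (hu k h2.le).trans_lt hk

/-- A form of Helly's selection theorem: bounded sequences of monotone functions have subsequences
that converge almost everywhere, to functions that are everywhere limits along a finer filter. -/
theorem exists_subseq_tendsto_of_monotone {u v : ℕ → ℝ → ℝ} {M : ℝ}
    (hu : ∀ k, Antitone (u k)) (hv : ∀ k, Monotone (v k))
    (huM : ∀ k θ, u k θ ∈ Icc 0 M) (hvM : ∀ k θ, v k θ ∈ Icc 0 M) :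
    ∃ (φ : ℕ → ℕ) (U : Ultrafilter ℕ) (α β : ℝ → ℝ), StrictMono φ ∧
      (∀ θ, Tendsto (fun k => u (φ k) θ) U (𝓝 (α θ))) ∧
      (∀ θ, Tendsto (fun k => v (φ k) θ) U (𝓝 (β θ))) ∧
      (∀ᵐ θ : ℝ, Tendsto (fun k => u (φ k) θ) atTop (𝓝 (α θ))) ∧
      (∀ᵐ θ : ℝ, Tendsto (fun k => v (φ k) θ) atTop (𝓝 (β θ))) := by
  have hcpt : IsCompact (Set.univ.pi fun _ : ℚ => Icc (0 : ℝ) M ×ˢ Icc (0 : ℝ) M) :=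
    isCompact_univ_pi fun _ => isCompact_Icc.prod isCompact_Icc
  obtain ⟨z, -, φ, hφ, hz⟩ := hcpt.tendsto_subseq
    (x := fun k (q : ℚ) => (u k (q : ℝ), v k (q : ℝ)))
    fun k => mem_univ_pi.2 fun q => ⟨huM k q, hvM k q⟩
  have hz' : ∀ q : ℚ, Tendsto (fun k => (u (φ k) (q : ℝ), v (φ k) (q : ℝ))) atTop (𝓝 (z q)) :=
    fun q => (tendsto_pi_nhds.1 hz) q
  -- Ultrafilter limits exist at every point, so pointwise constraints pass to the limit; they agree
  -- with the sequential limits at rationals, hence at continuity points.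
  set U : Ultrafilter ℕ := Ultrafilter.of atTop with hU
  have hUle : (U : Filter ℕ) ≤ atTop := Ultrafilter.of_le atTop
  have hlim : ∀ w : ℕ → ℝ, (∀ k, w k ∈ Icc 0 M) → ∃ y, Tendsto w U (𝓝 y) := by
    intro w hw
    obtain ⟨y, -, hy⟩ := (isCompact_Icc (a := (0 : ℝ)) (b := M)).ultrafilter_le_nhds
      (U.map w) (le_principal_iff.2 (Filter.mem_map.2 (Filter.Eventually.of_forall hw)))
    exact ⟨y, hy⟩
  choose α hα using fun θ => hlim (fun k => u (φ k) θ) fun k => huM _ _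
  choose β hβ using fun θ => hlim (fun k => v (φ k) θ) fun k => hvM _ _
  have hαq : ∀ q : ℚ, Tendsto (fun k => u (φ k) q) atTop (𝓝 (α q)) := fun q => by
    have h1 := (continuous_fst.tendsto _).comp (hz' q)
    rwa [tendsto_nhds_unique (hα q) (h1.mono_left hUle)]
  have hβq : ∀ q : ℚ, Tendsto (fun k => v (φ k) q) atTop (𝓝 (β q)) := fun q => by
    have h1 := (continuous_snd.tendsto _).comp (hz' q)
    rwa [tendsto_nhds_unique (hβ q) (h1.mono_left hUle)]
  have hαa : Antitone α := fun x y hxy =>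
    le_of_tendsto_of_tendsto' (hα y) (hα x) fun k => hu _ hxy
  have hβm : Monotone β := fun x y hxy =>
    le_of_tendsto_of_tendsto' (hβ x) (hβ y) fun k => hv _ hxy
  refine ⟨φ, U, α, β, hφ, hα, hβ, ?_, ?_⟩
  · filter_upwards [hαa.countable_not_continuousAt.ae_notMem volume] with θ hθ
    exact tendsto_of_antitone_of_continuousAt (fun k => hu (φ k)) hαq
      (not_not.1 hθ)
  · filter_upwards [hβm.countable_not_continuousAt.ae_notMem volume] with θ hθ
    have hc : ContinuousAt β θ := not_not.1 hθ
    have := tendsto_of_antitone_of_continuousAt (u := fun k => -v (φ k)) (α := -β)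
      (fun k => (hv (φ k)).neg) (fun q => (hβq q).neg) hc.neg
    simpa using this.neg

/-! ### Mechanisms and compactness of the feasible set. -/

namespace WorkerGroup

variable {g : WorkerGroup} {a b : ℝ → ℝ}

theorem lo_mem (g : WorkerGroup) : g.lo ∈ Icc g.lo g.hi := left_mem_Icc.2 g.lo_lt_hi.le

theorem hi_mem (g : WorkerGroup) : g.hi ∈ Icc g.lo g.hi := right_mem_Icc.2 g.lo_lt_hi.le

theorem intervalIntegrable_density (g : WorkerGroup) :
    IntervalIntegrable g.density volume g.lo g.hi :=
  (intervalIntegrable_iff_integrableOn_Icc_of_le g.lo_lt_hi.le).2 g.density_integrable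

theorem intervalIntegrable_density_of_mem (g : WorkerGroup) {s t : ℝ} (hs : s ∈ Icc g.lo g.hi)
    (ht : t ∈ Icc g.lo g.hi) : IntervalIntegrable g.density volume s t :=
  g.intervalIntegrable_density.mono_set (by
    rw [uIcc_of_le g.lo_lt_hi.le]; exact uIcc_subset_Icc hs ht)

theorem IsMechanism.antitoneOn (h : g.IsMechanism a b) : AntitoneOn a (Icc g.lo g.hi) := by
  intro x hx y hy hxy
  rcases hxy.eq_or_lt with rfl | hlt
  · exact le_rfl
  have h1 := h.ic x hx y hy
  have h2 := h.ic y hy x hx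
  by_contra! hc
  nlinarith [mul_pos (sub_pos.2 hc) (sub_pos.2 hlt)]

theorem IsMechanism.monotoneOn (h : g.IsMechanism a b) : MonotoneOn b (Icc g.lo g.hi) := by
  intro x hx y hy hxy
  have h1 := h.ic x hx y hy
  have h2 := h.antitoneOn hx hy hxy
  have h3 : 0 ≤ x := g.lo_pos.le.trans hx.1
  nlinarith [mul_nonneg (sub_nonneg.2 h2) h3]

/-- A uniform bound for the assignments of all mechanisms. -/
def bound (g : WorkerGroup) : ℝ := g.R g.lo / g.lo * (g.hi + 1) + g.R g.lo

theorem IsMechanism.le_bound (h : g.IsMechanism a b) {θ : ℝ} (hθ : θ ∈ Icc g.lo g.hi) :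
    a θ ≤ g.bound ∧ b θ ≤ g.bound := by
  have hlo := g.lo_mem
  have h1 := h.ir _ hlo
  have h2 := h.nonneg_a _ hlo
  have h3 := h.nonneg_b _ hlo
  have hR := g.R_nonneg _ hlo
  have hp := g.lo_pos
  have h4 : a g.lo ≤ g.R g.lo / g.lo := (le_div_iff₀ hp).2 (by linarith)
  have h5 := h.antitoneOn hlo hθ hθ.1
  have h6 : 0 ≤ g.R g.lo / g.lo := div_nonneg hR hp.le
  have hhi : 0 < g.hi := hp.trans g.lo_lt_hi
  have h7 := mul_nonneg h6 hhi.le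
  have h8 := h.ic θ hθ _ hlo
  have h9 := h.nonneg_a _ hθ
  have hθ0 : 0 ≤ θ := hp.le.trans hθ.1
  have h10 : a g.lo * θ ≤ g.R g.lo / g.lo * g.hi := mul_le_mul h4 hθ.2 hθ0 h6
  have h11 := mul_nonneg h9 hθ0
  have h12 := mul_nonneg h2 hp.le
  unfold bound
  constructor <;> linarith

/-- Mechanisms extended monotonically to all real types. -/
structure IsRegularMechanism (g : WorkerGroup) (a b : ℝ → ℝ) : Prop extends
    g.IsMechanism a b where
  antitone : Antitone a
  monotone : Monotone b
  mem_a : ∀ θ, a θ ∈ Icc 0 g.bound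
  mem_b : ∀ θ, b θ ∈ Icc 0 g.bound

theorem expect_congr {a a' : ℝ → ℝ} (h : ∀ θ ∈ Icc g.lo g.hi, a θ = a' θ) :
    g.expect a = g.expect a' :=
  intervalIntegral.integral_congr fun θ hθ => by
    rw [uIcc_of_le g.lo_lt_hi.le] at hθ
    simp only [h θ hθ]

/-- Composing with the projection onto the type interval extends both components monotonically and
leaves the expectations unchanged. -/
theorem exists_isRegularMechanism {n : ℝ × ℝ} (hn : n ∈ g.feasibleSet) :
    ∃ a b, g.IsRegularMechanism a b ∧ n = (g.expect a, g.expect b) := by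
  obtain ⟨a, b, h, rfl⟩ := hn
  have hle := g.lo_lt_hi.le
  set π : ℝ → ℝ := fun θ => projIcc g.lo g.hi hle θ with hπ
  have hmem : ∀ θ, π θ ∈ Icc g.lo g.hi := fun θ => (projIcc g.lo g.hi hle θ).2
  have hmono : Monotone π := fun x y hxy => monotone_projIcc hle hxy
  have hid : ∀ θ ∈ Icc g.lo g.hi, π θ = θ := fun θ hθ => by
    simp only [hπ, projIcc_of_mem hle hθ]
  have ha : ∀ θ ∈ Icc g.lo g.hi, a (π θ) = a θ := fun θ hθ => by rw [hid θ hθ]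
  have hb : ∀ θ ∈ Icc g.lo g.hi, b (π θ) = b θ := fun θ hθ => by rw [hid θ hθ]
  refine ⟨fun θ => a (π θ), fun θ => b (π θ), ⟨⟨fun θ _ => h.nonneg_a _ (hmem θ),
    fun θ _ => h.nonneg_b _ (hmem θ), fun θ hθ θ' hθ' => ?_, fun θ hθ => ?_⟩,
    fun x y hxy => h.antitoneOn (hmem x) (hmem y) (hmono hxy),
    fun x y hxy => h.monotoneOn (hmem x) (hmem y) (hmono hxy),
    fun θ => ⟨h.nonneg_a _ (hmem θ), (h.le_bound (hmem θ)).1⟩,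
    fun θ => ⟨h.nonneg_b _ (hmem θ), (h.le_bound (hmem θ)).2⟩⟩, ?_⟩
  · rw [ha θ hθ, hb θ hθ, ha θ' hθ', hb θ' hθ']; exact h.ic θ hθ θ' hθ'
  · rw [ha θ hθ, hb θ hθ]; exact h.ir θ hθ
  · rw [expect_congr ha, expect_congr hb]

theorem intervalIntegrable_mul_of_bounded {a h : ℝ → ℝ} {M s t : ℝ} (ha : Measurable a)
    (haM : ∀ θ, a θ ∈ Icc 0 M) (hh : IntervalIntegrable h volume s t) :
    IntervalIntegrable (fun θ => a θ * h θ) volume s t :=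
  ⟨hh.1.bdd_mul (c := M) ha.aestronglyMeasurable (Eventually.of_forall fun θ => by
      rw [Real.norm_of_nonneg (haM θ).1]; exact (haM θ).2),
    hh.2.bdd_mul (c := M) ha.aestronglyMeasurable (Eventually.of_forall fun θ => by
      rw [Real.norm_of_nonneg (haM θ).1]; exact (haM θ).2)⟩

theorem expect_nonneg (h : ∀ θ ∈ Icc g.lo g.hi, 0 ≤ a θ) : 0 ≤ g.expect a :=
  intervalIntegral.integral_nonneg g.lo_lt_hi.le fun θ hθ =>
    mul_nonneg (h θ hθ) (g.density_pos θ hθ).le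

theorem expect_const (g : WorkerGroup) (c : ℝ) : g.expect (fun _ => c) = c := by
  simp [expect, g.density_mass]

theorem expect_le_of_bounded {M : ℝ} (ha : Measurable a) (haM : ∀ θ, a θ ∈ Icc 0 M) {c : ℝ}
    (h : ∀ θ ∈ Icc g.lo g.hi, a θ ≤ c) : g.expect a ≤ c := by
  rw [← g.expect_const c]
  exact intervalIntegral.integral_mono_on g.lo_lt_hi.le
    (intervalIntegrable_mul_of_bounded ha haM g.intervalIntegrable_density)
    (g.intervalIntegrable_density.const_mul c)
    fun θ hθ => mul_le_mul_of_nonneg_right (h θ hθ) (g.density_pos θ hθ).le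

theorem zero_mem_feasibleSet (g : WorkerGroup) : (0 : ℝ × ℝ) ∈ g.feasibleSet :=
  ⟨fun _ => 0, fun _ => 0, ⟨fun _ _ => le_rfl, fun _ _ => le_rfl, fun _ _ _ _ => by simp,
    fun θ hθ => by simpa using g.R_nonneg θ hθ⟩, by simp [expect]; rfl⟩

theorem nonneg_of_mem_feasibleSet {n : ℝ × ℝ} (hn : n ∈ g.feasibleSet) : 0 ≤ n := by
  obtain ⟨a, b, h, rfl⟩ := hn
  exact ⟨expect_nonneg h.nonneg_a, expect_nonneg h.nonneg_b⟩

theorem tendsto_expect {u : ℕ → ℝ → ℝ} {α : ℝ → ℝ} {M : ℝ} (hu : ∀ k, Measurable (u k))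
    (huM : ∀ k θ, u k θ ∈ Icc 0 M) (h : ∀ᵐ θ : ℝ, Tendsto (fun k => u k θ) atTop (𝓝 (α θ))) :
    Tendsto (fun k => g.expect (u k)) atTop (𝓝 (g.expect α)) := by
  refine intervalIntegral.tendsto_integral_filter_of_dominated_convergence
    (fun θ => M * ‖g.density θ‖) (Eventually.of_forall fun k => ?_)
    (Eventually.of_forall fun k => Eventually.of_forall fun θ _ => ?_)
    (g.intervalIntegrable_density.norm.const_mul M) ?_
  · exact (hu k).aestronglyMeasurable.mul
      g.intervalIntegrable_density.aestronglyMeasurable_restrict_uIoc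
  · rw [norm_mul, Real.norm_of_nonneg (huM k θ).1]
    exact mul_le_mul_of_nonneg_right (huM k θ).2 (norm_nonneg _)
  · filter_upwards [h] with θ hθ _
    exact hθ.mul_const _

/-- The incentive-feasible set is compact. -/
theorem isCompact_feasibleSet (g : WorkerGroup) : IsCompact g.feasibleSet := by
  refine (isCompact_Icc (a := (0 : ℝ × ℝ)) (b := (g.bound, g.bound))).of_isClosed_subset
    (isSeqClosed_iff_isClosed.1 ?_) ?_
  · intro n m hn hm
    choose u v h hE using fun k => exists_isRegularMechanism (hn k)
    obtain ⟨φ, U, α, β, hφ, hα, hβ, hαt, hβt⟩ := exists_subseq_tendsto_of_monotone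
      (fun k => (h k).antitone) (fun k => (h k).monotone) (fun k => (h k).mem_a)
      (fun k => (h k).mem_b)
    refine ⟨α, β, ⟨fun θ _ => ge_of_tendsto' (hα θ) fun k => ((h _).mem_a θ).1,
      fun θ _ => ge_of_tendsto' (hβ θ) fun k => ((h _).mem_b θ).1, fun θ hθ θ' hθ' => ?_,
      fun θ hθ => ?_⟩, ?_⟩
    · exact le_of_tendsto_of_tendsto' (((hα θ).mul_const θ).add (hβ θ))
        (((hα θ').mul_const θ).add (hβ θ')) fun k => (h _).ic θ hθ θ' hθ'
    · exact le_of_tendsto' (((hα θ).mul_const θ).add (hβ θ)) fun k => (h _).ir θ hθ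
    · have h1 := (tendsto_expect (g := g) (fun k => (h (φ k)).antitone.measurable)
        (fun k => (h _).mem_a) hαt).prodMk_nhds
        (tendsto_expect (g := g) (fun k => (h (φ k)).monotone.measurable)
        (fun k => (h _).mem_b) hβt)
      refine tendsto_nhds_unique (hm.comp hφ.tendsto_atTop) (h1.congr fun k => ?_)
      exact (hE _).symm
  · intro n hn
    obtain ⟨a, b, h, rfl⟩ := exists_isRegularMechanism hn
    exact ⟨⟨expect_nonneg h.nonneg_a, expect_nonneg h.nonneg_b⟩,
      ⟨expect_le_of_bounded h.antitone.measurable h.mem_a fun θ _ => (h.mem_a θ).2,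
      expect_le_of_bounded h.monotone.measurable h.mem_b fun θ _ => (h.mem_b θ).2⟩⟩

end WorkerGroup

/-! ### A second mean value inequality and integration by parts. -/

/-- A superlevel set of an antitone function is an initial segment up to an endpoint, so the
integral is a value of the primitive of `h`. -/
theorem integral_indicator_lt_le_of_antitone {a h : ℝ → ℝ} {l r K : ℝ} (hlr : l ≤ r)
    (ha : Antitone a) (hh : IntervalIntegrable h volume l r)
    (hK : ∀ t ∈ Icc l r, ∫ θ in l..t, h θ ≤ K) (c : ℝ) :
    ∫ θ in l..r, {θ | c < a θ}.indicator h θ ≤ K := by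
  set T : Set ℝ := insert l {θ ∈ Icc l r | c < a θ} with hT
  have hTb : BddAbove T := ⟨r, by
    rintro θ (rfl | h)
    exacts [hlr, h.1.2]⟩
  have hlT : l ≤ sSup T := le_csSup hTb (mem_insert _ _)
  have hTr : sSup T ≤ r := csSup_le (insert_nonempty _ _) (by
    rintro θ (rfl | h)
    exacts [hlr, h.1.2])
  have hle : ∀ θ, θ ∈ Icc l r → c < a θ → θ ≤ sSup T := fun θ h1 h2 =>
    le_csSup hTb (mem_insert_of_mem _ ⟨h1, h2⟩)
  have hlt : ∀ θ, l < θ → θ < sSup T → c < a θ := by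
    intro θ h1 h2
    obtain ⟨s, hs, hθs⟩ := exists_lt_of_lt_csSup (insert_nonempty _ _) h2
    rcases hs with rfl | hs
    · exact absurd h1 (not_lt.2 hθs.le)
    · exact hs.2.trans_le (ha hθs.le)
  have hint : IntervalIntegrable ({θ | c < a θ}.indicator h) volume l r :=
    have hm : MeasurableSet {θ | c < a θ} := measurableSet_lt measurable_const ha.measurable
    ⟨hh.1.indicator hm, hh.2.indicator hm⟩
  have hmem : sSup T ∈ uIcc l r := by rw [uIcc_of_le hlr]; exact ⟨hlT, hTr⟩
  rw [← intervalIntegral.integral_add_adjacent_intervals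
    (hint.mono_set (uIcc_subset_uIcc_left hmem)) (hint.mono_set (uIcc_subset_uIcc_right hmem))]
  have hne : ∀ᵐ θ : ℝ, θ ≠ sSup T := (countable_singleton (sSup T)).ae_notMem volume
  have h1 : ∫ θ in l..sSup T, {θ | c < a θ}.indicator h θ = ∫ θ in l..sSup T, h θ := by
    refine intervalIntegral.integral_congr_ae ?_
    filter_upwards [hne] with θ hθ hmem
    rw [uIoc_of_le hlT] at hmem
    exact indicator_of_mem (show θ ∈ {θ | c < a θ} from
      hlt θ hmem.1 (lt_of_le_of_ne hmem.2 hθ)) h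
  have h2 : ∫ θ in sSup T..r, {θ | c < a θ}.indicator h θ = 0 := by
    refine intervalIntegral.integral_zero_ae (Eventually.of_forall fun θ hmem => ?_)
    rw [uIoc_of_le hTr] at hmem
    exact indicator_of_notMem (show θ ∉ {θ | c < a θ} from
      fun hc => absurd (hle θ ⟨hlT.trans hmem.1.le, hmem.2⟩ hc) (not_le.2 hmem.1)) h
  rw [h1, h2, add_zero]
  exact hK _ ⟨hlT, hTr⟩

/-- A one-sided form of the second mean value theorem for integrals. -/
theorem integral_mul_le_of_antitone {a h : ℝ → ℝ} {l r K : ℝ} (hlr : l ≤ r) (ha : Antitone a)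
    (ha0 : ∀ θ, 0 ≤ a θ) (hh : IntervalIntegrable h volume l r)
    (hK : ∀ t ∈ Icc l r, ∫ θ in l..t, h θ ≤ K) : ∫ θ in l..r, a θ * h θ ≤ K * a l := by
  -- Layer-cake representation of `a θ`; exchanging the integrals reduces the claim to superlevel
  -- sets.
  have h1 : ∀ θ ∈ uIcc l r, a θ * h θ = ∫ c in (0 : ℝ)..a l, {θ | c < a θ}.indicator h θ := by
    intro θ hθ
    rw [uIcc_of_le hlr] at hθ
    have hal : a θ ≤ a l := ha hθ.1
    have e1 : EqOn (fun c => {θ | c < a θ}.indicator h θ) (fun _ => 0) (Ioc (a θ) (a l)) :=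
      fun c hc => indicator_of_notMem (show θ ∉ {θ | c < a θ} from not_lt.2 hc.1.le) h
    have e0 : ∀ᵐ c : ℝ, c ∈ Ioc 0 (a θ) → {θ | c < a θ}.indicator h θ = h θ := by
      filter_upwards [(countable_singleton (a θ)).ae_notMem volume] with c hc hmem
      exact indicator_of_mem (show θ ∈ {θ | c < a θ} from lt_of_le_of_ne hmem.2 hc) h
    have i1 : IntervalIntegrable (fun c => {θ | c < a θ}.indicator h θ) volume (a θ) (a l) :=
      (intervalIntegrable_const (c := (0 : ℝ))).congr (by
        rw [uIoc_of_le hal]; exact e1.symm)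
    have i0 : IntervalIntegrable (fun c => {θ | c < a θ}.indicator h θ) volume 0 (a θ) :=
      (intervalIntegrable_const (c := h θ)).congr_ae (by
        rw [uIoc_of_le (ha0 θ)]
        exact (ae_restrict_iff' measurableSet_Ioc).2 (e0.mono fun c hc hm => (hc hm).symm))
    rw [← intervalIntegral.integral_add_adjacent_intervals i0 i1,
      intervalIntegral.integral_congr_ae (g := fun _ => h θ) (by rwa [uIoc_of_le (ha0 θ)]),
      intervalIntegral.integral_zero_ae (a := a θ) (b := a l) (Eventually.of_forall (by
        rw [uIoc_of_le hal]; exact fun c hc => e1 hc))]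
    simp
  rw [intervalIntegral.integral_congr h1, intervalIntegral_intervalIntegral_swap]
  · have hK0 : ∀ c, ∫ θ in l..r, {θ | c < a θ}.indicator h θ ≤ K := fun c =>
      integral_indicator_lt_le_of_antitone hlr ha hh hK c
    by_cases hi : IntervalIntegrable (fun c => ∫ θ in l..r, {θ | c < a θ}.indicator h θ)
      volume 0 (a l)
    · refine (intervalIntegral.integral_mono_on (ha0 l) hi intervalIntegrable_const
        fun c _ => hK0 c).trans_eq ?_
      simp [mul_comm]
    · rw [intervalIntegral.integral_undef hi]
      have := hK l (left_mem_Icc.2 hlr)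
      rw [intervalIntegral.integral_same] at this
      exact mul_nonneg this (ha0 l)
  · have hm : MeasurableSet {z : ℝ × ℝ | z.2 < a z.1} :=
      measurableSet_lt measurable_snd (ha.measurable.comp measurable_fst)
    have hprod : IntegrableOn (fun z : ℝ × ℝ => h z.1) (uIoc l r ×ˢ uIoc 0 (a l)) := by
      rw [IntegrableOn, Measure.volume_eq_prod, ← Measure.prod_restrict]
      have : IsFiniteMeasure (volume.restrict (uIoc 0 (a l))) :=
        ⟨by rw [Measure.restrict_apply_univ, uIoc_of_le (ha0 l)]; exact measure_Ioc_lt_top⟩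
      exact Integrable.comp_fst (intervalIntegrable_iff.1 hh) _
    exact hprod.indicator hm

theorem integral_mul_primitive_add {v f : ℝ → ℝ} {l s : ℝ} (u₀ : ℝ)
    (hv : IntervalIntegrable v volume l s) (hf : IntervalIntegrable f volume l s) :
    ∫ θ in l..s, (v θ * (∫ t in l..θ, f t) + (u₀ + ∫ t in l..θ, v t) * f θ)
      = (u₀ + ∫ t in l..s, v t) * ∫ t in l..s, f t := by
  have hl : l ∈ uIcc l s := left_mem_uIcc
  have hV := hv.absolutelyContinuousOnInterval_intervalIntegral hl
  have hU : AbsolutelyContinuousOnInterval (fun x => u₀ + ∫ t in l..x, v t) l s :=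
    (LipschitzWith.const u₀).lipschitzOnWith.absolutelyContinuousOnInterval.add hV
  have hP := hf.absolutelyContinuousOnInterval_intervalIntegral hl
  have h := hU.integral_deriv_mul_eq_sub hP
  rw [intervalIntegral.integral_same (f := f), mul_zero, sub_zero] at h
  rw [← h]
  refine intervalIntegral.integral_congr_ae ?_
  filter_upwards [hv.ae_hasDerivAt_integral, hf.ae_hasDerivAt_integral] with x h1 h2 hx
  have hx' := uIoc_subset_uIcc hx
  rw [((h1 hx' l hl).const_add u₀).deriv, (h2 hx' l hl).deriv]

/-! ### Envelope formula and low heterogeneity. -/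

namespace WorkerGroup

variable {g : WorkerGroup} {a b : ℝ → ℝ}

/-- Incentive compatibility in both directions traps the remainder between `(a y - a x) * (y - x)`
and `0`. -/
theorem IsMechanism.abs_sub_le (h : g.IsMechanism a b) {x y : ℝ} (hx : x ∈ Icc g.lo g.hi)
    (hy : y ∈ Icc g.lo g.hi) :
    |a y * y + b y - (a x * x + b x) - a x * (y - x)| ≤ |a y - a x| * |y - x| := by
  have h1 := h.ic x hx y hy
  have h2 := h.ic y hy x hx
  rw [← abs_mul, abs_of_nonpos (by linarith)]
  refine le_trans ?_ (neg_le_abs _)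
  linarith

/-- The envelope formula for the workload. -/
theorem IsRegularMechanism.integral_eq (h : g.IsRegularMechanism a b) {s t : ℝ} (hst : s ≤ t)
    (hs : s ∈ Icc g.lo g.hi) (ht : t ∈ Icc g.lo g.hi) :
    ∫ θ in s..t, a θ = a t * t + b t - (a s * s + b s) := by
  have hsub : Icc s t ⊆ Icc g.lo g.hi := Icc_subset_Icc hs.1 ht.2
  refine integral_eq_of_hasDerivAt_off_countable_of_le (fun θ => a θ * θ + b θ) a hst
    h.antitone.countable_not_continuousAt ?_ ?_ h.antitone.intervalIntegrable
  · intro x hx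
    have hlim : Tendsto (fun y => 2 * g.bound * |y - x|) (𝓝[Icc s t] x) (𝓝 0) := by
      have : Continuous fun y => 2 * g.bound * |y - x| := by fun_prop
      simpa using (this.tendsto x).mono_left nhdsWithin_le_nhds
    refine tendsto_iff_norm_sub_tendsto_zero.2 (squeeze_zero' (Eventually.of_forall fun _ =>
      norm_nonneg _) ?_ hlim)
    filter_upwards [self_mem_nhdsWithin] with y hy
    have h1 := h.abs_sub_le (hsub hx) (hsub hy)
    have h2 : |a y - a x| ≤ g.bound := abs_sub_le_of_nonneg_of_le (h.mem_a y).1 (h.mem_a y).2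
      (h.mem_a x).1 (h.mem_a x).2
    have h3 : |a x * (y - x)| ≤ g.bound * |y - x| := by
      rw [abs_mul, abs_of_nonneg (h.mem_a x).1]
      exact mul_le_mul_of_nonneg_right (h.mem_a x).2 (abs_nonneg _)
    have h4 := mul_le_mul_of_nonneg_right h2 (abs_nonneg (y - x))
    have h5 := abs_sub_abs_le_abs_sub (a y * y + b y - (a x * x + b x)) (a x * (y - x))
    rw [Real.norm_eq_abs]
    linarith
  · rintro x ⟨hx, hc⟩
    have hc' : ContinuousAt a x := not_not.1 hc
    have hxI : x ∈ Icc g.lo g.hi := hsub ⟨hx.1.le, hx.2.le⟩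
    rw [hasDerivAt_iff_isLittleO, Asymptotics.isLittleO_iff]
    intro ε hε
    have h1 : ∀ᶠ y in 𝓝 x, |a y - a x| < ε := by
      have := Metric.tendsto_nhds.1 hc' ε hε
      simpa only [Real.dist_eq] using this
    filter_upwards [h1, Ioo_mem_nhds hx.1 hx.2] with y hy hyI
    have h2 := h.abs_sub_le hxI (hsub ⟨hyI.1.le, hyI.2.le⟩)
    rw [Real.norm_eq_abs, Real.norm_eq_abs, smul_eq_mul, mul_comm (y - x)]
    exact h2.trans (mul_le_mul_of_nonneg_right hy.le (abs_nonneg _))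

/-- If the type distribution is not too spread out at the bottom, the average of task `B` is at
most the workload of the lowest type. -/
theorem IsRegularMechanism.expect_snd_le (h : g.IsRegularMechanism a b)
    (hlow : ∀ θ ∈ Icc g.lo g.hi, 1 - g.lo / θ ≤ g.cdf θ) :
    g.expect b ≤ a g.lo * g.lo + b g.lo := by
  have hle := g.lo_lt_hi.le
  have hf := g.intervalIntegrable_density
  have ha : IntervalIntegrable a volume g.lo g.hi := h.antitone.intervalIntegrable
  set V₀ := a g.lo * g.lo + b g.lo with hV₀
  have hV : ∀ θ ∈ Icc g.lo g.hi, a θ * θ + b θ = V₀ + ∫ t in g.lo..θ, a t := fun θ hθ => by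
    rw [h.integral_eq hθ.1 g.lo_mem hθ]; ring
  have hcdf : ContinuousOn g.cdf (uIcc g.lo g.hi) :=
    (hf.absolutelyContinuousOnInterval_intervalIntegral left_mem_uIcc).continuousOn
  have hh : IntervalIntegrable (fun θ => 1 - g.cdf θ - θ * g.density θ) volume g.lo g.hi :=
    (intervalIntegrable_const.sub hcdf.intervalIntegrable).sub
      (hf.continuousOn_mul continuousOn_id)
  -- The primitive is `t - lo - t * cdf t`, and its sign is exactly the assumed bound.
  have hK : ∀ t ∈ Icc g.lo g.hi, ∫ θ in g.lo..t, (1 - g.cdf θ - θ * g.density θ) ≤ 0 := by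
    intro t ht
    have hsub : uIcc g.lo t ⊆ uIcc g.lo g.hi := by
      rw [uIcc_of_le ht.1, uIcc_of_le hle]; exact Icc_subset_Icc_right ht.2
    have hp := integral_mul_primitive_add (v := fun _ => 1) g.lo
      (intervalIntegrable_const (a := g.lo) (b := t)) (hf.mono_set hsub)
    simp only [intervalIntegral.integral_const, smul_eq_mul, mul_one, one_mul,
      add_sub_cancel] at hp
    have hi2 : IntervalIntegrable (fun θ => g.cdf θ + θ * g.density θ) volume g.lo t :=
      (hcdf.mono hsub).intervalIntegrable.add
        ((hf.mono_set hsub).continuousOn_mul continuousOn_id)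
    have h1 : ∫ θ in g.lo..t, (1 - g.cdf θ - θ * g.density θ)
        = (t - g.lo) - ∫ θ in g.lo..t, (g.cdf θ + θ * g.density θ) := by
      have := intervalIntegral.integral_sub (intervalIntegrable_const (c := (1 : ℝ))) hi2
      rw [intervalIntegral.integral_const, smul_eq_mul, mul_one] at this
      rw [← this]
      exact intervalIntegral.integral_congr fun θ _ => by ring
    have h2 : ∫ θ in g.lo..t, (g.cdf θ + θ * g.density θ) = t * g.cdf t := hp
    have ht0 : 0 < t := g.lo_pos.trans_le ht.1
    have h3 := hlow t ht
    rw [sub_le_iff_le_add, ← sub_le_iff_le_add', le_div_iff₀ ht0] at h3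
    rw [h1, h2]
    linarith
  have hmain := integral_mul_le_of_antitone hle h.antitone (fun θ => (h.mem_a θ).1) hh hK
  have hp := integral_mul_primitive_add V₀ ha hf
  rw [g.density_mass, mul_one] at hp
  have haF : IntervalIntegrable (fun θ => a θ * g.cdf θ) volume g.lo g.hi :=
    ha.mul_continuousOn hcdf
  have haθ : IntervalIntegrable (fun θ => a θ * (θ * g.density θ)) volume g.lo g.hi :=
    intervalIntegrable_mul_of_bounded h.antitone.measurable h.mem_a
      (hf.continuousOn_mul continuousOn_id)
  have hbf : IntervalIntegrable (fun θ => b θ * g.density θ) volume g.lo g.hi :=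
    intervalIntegrable_mul_of_bounded h.monotone.measurable h.mem_b hf
  have h1 : ∫ θ in g.lo..g.hi, (a θ * g.cdf θ + (a θ * (θ * g.density θ) + b θ * g.density θ))
      = V₀ + ∫ θ in g.lo..g.hi, a θ := by
    rw [← hp]
    refine intervalIntegral.integral_congr fun θ hθ => ?_
    rw [uIcc_of_le hle] at hθ
    rw [← hV θ hθ, cdf]
    ring
  have h2 : ∫ θ in g.lo..g.hi, a θ * (1 - g.cdf θ - θ * g.density θ)
      = (∫ θ in g.lo..g.hi, a θ) - ((∫ θ in g.lo..g.hi, a θ * g.cdf θ)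
        + ∫ θ in g.lo..g.hi, a θ * (θ * g.density θ)) := by
    rw [← intervalIntegral.integral_add haF haθ, ← intervalIntegral.integral_sub ha (haF.add haθ)]
    exact intervalIntegral.integral_congr fun θ _ => by ring
  rw [intervalIntegral.integral_add haF (haθ.add hbf), intervalIntegral.integral_add haθ hbf] at h1
  have h3 : g.expect b = ∫ θ in g.lo..g.hi, b θ * g.density θ := rfl
  linarith

/-- If the type distribution is not too spread out at the top, the average of task `A` is at
most its average cost to the highest type. -/
theorem IsRegularMechanism.mul_expect_fst_le (h : g.IsRegularMechanism a b)
    (hlow : ∀ θ ∈ Icc g.lo g.hi, g.cdf θ ≤ θ / g.hi) :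
    g.hi * g.expect a ≤ a g.hi * g.hi + b g.hi := by
  have hle := g.lo_lt_hi.le
  have hf := g.intervalIntegrable_density
  have hhi : 0 < g.hi := g.lo_pos.trans g.lo_lt_hi
  have ha : IntervalIntegrable a volume g.lo g.hi := h.antitone.intervalIntegrable
  -- The primitive is `hi * cdf t - (t - lo)`. The resulting term `lo * a lo` later cancels against
  -- the workload of the lowest type, leaving `b lo ≥ 0`.
  have hK : ∀ t ∈ Icc g.lo g.hi, ∫ θ in g.lo..t, (g.hi * g.density θ - 1) ≤ g.lo := by
    intro t ht
    rw [intervalIntegral.integral_sub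
      ((g.intervalIntegrable_density_of_mem g.lo_mem ht).const_mul _) intervalIntegrable_const,
      intervalIntegral.integral_const_mul, intervalIntegral.integral_const, smul_eq_mul, mul_one]
    have h1 := (le_div_iff₀ hhi).1 (hlow t ht)
    unfold cdf at h1
    linarith
  have hmain := integral_mul_le_of_antitone hle h.antitone (fun θ => (h.mem_a θ).1)
    ((hf.const_mul g.hi).sub intervalIntegrable_const) hK
  have h1 : ∫ θ in g.lo..g.hi, a θ * (g.hi * g.density θ - 1)
      = g.hi * g.expect a - ∫ θ in g.lo..g.hi, a θ := by
    rw [expect, ← intervalIntegral.integral_const_mul, ← intervalIntegral.integral_sub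
      ((intervalIntegrable_mul_of_bounded h.antitone.measurable h.mem_a hf).const_mul _) ha]
    exact intervalIntegral.integral_congr fun θ _ => by ring
  have h2 := h.integral_eq hle g.lo_mem g.hi_mem
  have h3 := (h.mem_b g.lo).1
  linarith

/-- Giving everyone only task `B`, in the amount of the lowest type's workload, is individually
rational: `V(lo) ≤ a θ * lo + b θ ≤ R θ`. -/
theorem exists_snd_dominating (hlow : g.LowHeterogeneity) {n : ℝ × ℝ} (hn : n ∈ g.feasibleSet) :
    ∃ m, ((0 : ℝ), m) ∈ g.feasibleSet ∧ n.2 ≤ m := by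
  obtain ⟨a, b, h, rfl⟩ := exists_isRegularMechanism hn
  refine ⟨a g.lo * g.lo + b g.lo, ⟨fun _ => 0, fun _ => a g.lo * g.lo + b g.lo,
    ⟨fun _ _ => le_rfl, fun _ _ => ?_, fun _ _ _ _ => le_rfl, fun θ hθ => ?_⟩, ?_⟩,
    h.expect_snd_le fun θ hθ => (hlow θ hθ).1⟩
  · exact add_nonneg (mul_nonneg (h.mem_a _).1 g.lo_pos.le) (h.mem_b _).1
  · have h1 := h.ic _ g.lo_mem θ hθ
    have h2 := mul_le_mul_of_nonneg_left hθ.1 (h.mem_a θ).1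
    linarith [h.ir θ hθ]
  · rw [expect_const, expect_const]

theorem exists_fst_dominating (hlow : g.LowHeterogeneity) {n : ℝ × ℝ} (hn : n ∈ g.feasibleSet) :
    ∃ m, (m, (0 : ℝ)) ∈ g.feasibleSet ∧ n.1 ≤ m := by
  obtain ⟨a, b, h, rfl⟩ := exists_isRegularMechanism hn
  have hhi : 0 < g.hi := g.lo_pos.trans g.lo_lt_hi
  have hV : 0 ≤ a g.hi * g.hi + b g.hi :=
    add_nonneg (mul_nonneg (h.mem_a _).1 hhi.le) (h.mem_b _).1
  refine ⟨(a g.hi * g.hi + b g.hi) / g.hi, ⟨fun _ => (a g.hi * g.hi + b g.hi) / g.hi, fun _ => 0,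
    ⟨fun _ _ => div_nonneg hV hhi.le, fun _ _ => le_rfl, fun _ _ _ _ => le_rfl,
      fun θ hθ => ?_⟩, ?_⟩, ?_⟩
  · have hθ0 : 0 < θ := g.lo_pos.trans_le hθ.1
    have h1 := h.ic _ g.hi_mem θ hθ
    have h2 := mul_le_mul_of_nonneg_left hθ.2 (h.mem_b θ).1
    refine le_trans ?_ (h.ir θ hθ)
    rw [add_zero, div_mul_eq_mul_div, div_le_iff₀ hhi]
    nlinarith [mul_le_mul_of_nonneg_right h1 hθ0.le]
  · rw [expect_const, expect_const]
  · rw [le_div_iff₀ hhi, mul_comm]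
    exact h.mul_expect_fst_le fun θ hθ => (hlow θ hθ).2

end WorkerGroup

/-! ### Specialized allocations and two-step menus. -/

namespace WorkerGroup

variable {g : WorkerGroup} {a b : ℝ → ℝ}

theorem expect_step (g : WorkerGroup) (x y : ℝ) {t : ℝ} (ht : t ∈ Icc g.lo g.hi) :
    g.expect (fun θ => if θ ≤ t then x else y) = x * g.cdf t + y * (1 - g.cdf t) := by
  have i0 := g.intervalIntegrable_density_of_mem g.lo_mem ht
  have i1 := g.intervalIntegrable_density_of_mem ht g.hi_mem
  have e0 : EqOn (fun θ => x * g.density θ) (fun θ => (if θ ≤ t then x else y) * g.density θ)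
      (uIoc g.lo t) := fun θ hθ => by
    rw [uIoc_of_le ht.1] at hθ
    simp only [if_pos hθ.2]
  have e1 : EqOn (fun θ => y * g.density θ) (fun θ => (if θ ≤ t then x else y) * g.density θ)
      (uIoc t g.hi) := fun θ hθ => by
    rw [uIoc_of_le ht.2] at hθ
    simp only [if_neg (not_le.2 hθ.1)]
  have hmass := intervalIntegral.integral_add_adjacent_intervals i0 i1
  rw [g.density_mass] at hmass
  have hF : g.cdf t = ∫ θ in g.lo..t, g.density θ := rfl
  rw [expect, ← intervalIntegral.integral_add_adjacent_intervals
    ((i0.const_mul x).congr e0) ((i1.const_mul y).congr e1),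
    ← intervalIntegral.integral_congr_ae (Eventually.of_forall fun θ hθ => e0 hθ),
    ← intervalIntegral.integral_congr_ae (Eventually.of_forall fun θ hθ => e1 hθ),
    intervalIntegral.integral_const_mul, intervalIntegral.integral_const_mul, hF, ← hmass]
  ring

theorem ae_eq_zero_of_expect_eq_zero {M : ℝ} (ha : Measurable a) (haM : ∀ θ, a θ ∈ Icc 0 M)
    (h : g.expect a = 0) : ∀ᵐ θ : ℝ, θ ∈ Ioc g.lo g.hi → a θ = 0 := by
  have hle := g.lo_lt_hi.le
  have hi := intervalIntegrable_mul_of_bounded ha haM g.intervalIntegrable_density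
  rw [intervalIntegrable_iff_integrableOn_Ioc_of_le hle] at hi
  rw [expect, intervalIntegral.integral_of_le hle,
    setIntegral_eq_zero_iff_of_nonneg_ae ?_ hi] at h
  · rw [EventuallyEq, ae_restrict_iff' measurableSet_Ioc] at h
    filter_upwards [h] with θ hθ hmem
    exact (mul_eq_zero.1 (hθ hmem)).resolve_right (g.density_pos θ ⟨hmem.1.le, hmem.2⟩).ne'
  · refine (ae_restrict_iff' measurableSet_Ioc).2 (Eventually.of_forall fun θ hθ => ?_)
    exact mul_nonneg (haM θ).1 (g.density_pos θ ⟨hθ.1.le, hθ.2⟩).le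

/-- Here `a` vanishes almost everywhere, so by the envelope formula the workload stays at its value
at `lo`, which is at most `R lo`. -/
theorem snd_le_of_fst_eq_zero {n : ℝ × ℝ} (hn : n ∈ g.feasibleSet) (h0 : n.1 = 0) :
    n.2 ≤ g.R g.lo := by
  obtain ⟨a, b, h, rfl⟩ := exists_isRegularMechanism hn
  refine expect_le_of_bounded h.monotone.measurable h.mem_b fun θ hθ => ?_
  have hz := ae_eq_zero_of_expect_eq_zero h.antitone.measurable h.mem_a h0
  have h1 : ∫ t in g.lo..θ, a t = 0 := by
    refine intervalIntegral.integral_zero_ae ?_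
    filter_upwards [hz] with t ht hmem
    rw [uIoc_of_le hθ.1] at hmem
    exact ht ⟨hmem.1, hmem.2.trans hθ.2⟩
  rw [h.integral_eq hθ.1 g.lo_mem hθ] at h1
  have h2 := h.ir _ g.lo_mem
  have h3 := mul_nonneg (h.mem_a θ).1 (g.lo_pos.le.trans hθ.1)
  linarith

/-- Almost every report `t` has `b t = 0`, so incentive compatibility gives `a θ ≤ a t`. Integrating
and adding `a θ * lo ≤ a lo * lo` yields `hi * a θ ≤ R hi`. -/
theorem fst_le_of_snd_eq_zero {n : ℝ × ℝ} (hn : n ∈ g.feasibleSet) (h0 : n.2 = 0) :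
    n.1 ≤ g.R g.hi / g.hi := by
  obtain ⟨a, b, h, rfl⟩ := exists_isRegularMechanism hn
  have hle := g.lo_lt_hi.le
  have hhi : 0 < g.hi := g.lo_pos.trans g.lo_lt_hi
  refine expect_le_of_bounded h.antitone.measurable h.mem_a fun θ hθ => ?_
  have hθ0 : 0 < θ := g.lo_pos.trans_le hθ.1
  have hz := ae_eq_zero_of_expect_eq_zero h.monotone.measurable h.mem_b h0
  have h1 : ∫ _ in g.lo..g.hi, a θ ≤ ∫ t in g.lo..g.hi, a t := by
    refine intervalIntegral.integral_mono_ae_restrict hle intervalIntegrable_const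
      h.antitone.intervalIntegrable ?_
    have hzIcc : ∀ᵐ t : ℝ, t ≠ g.lo := (countable_singleton g.lo).ae_notMem volume
    refine (ae_restrict_iff' measurableSet_Icc).2 ?_
    filter_upwards [hz, hzIcc] with t ht hne hmem
    have h2 := h.ic θ hθ t hmem
    rw [ht ⟨lt_of_le_of_ne hmem.1 (Ne.symm hne), hmem.2⟩] at h2
    exact le_of_mul_le_mul_right (by linarith [(h.mem_b θ).1]) hθ0
  rw [intervalIntegral.integral_const, smul_eq_mul, h.integral_eq hle g.lo_mem g.hi_mem] at h1
  have h3 := h.ir _ g.hi_mem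
  have h4 := mul_le_mul_of_nonneg_right (h.antitone hθ.1) g.lo_pos.le
  have h5 := (h.mem_b g.lo).1
  rw [le_div_iff₀ hhi]
  linarith

/-- If the type distribution is too spread out at the bottom, screening raises the average of
task `B` above the reservation workload of the lowest type. -/
theorem exists_snd_gt (hr : g.RisesFromLowest) (hR : 0 < g.R g.lo) {t : ℝ}
    (ht : t ∈ Icc g.lo g.hi) (hcdf : g.cdf t < 1 - g.lo / t) :
    ∃ n ∈ g.feasibleSet, g.R g.lo < n.2 := by
  obtain ⟨κ, hκ, hrise⟩ := hr
  have hlo := g.lo_pos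
  have ht0 : 0 < t := hlo.trans_le ht.1
  -- The bound by `κ` secures participation, the other one `b ≥ 0`. In the menu type `t` is
  -- indifferent, and the mean of `b` is `R lo - c * lo + c * t * (1 - cdf t)`.
  set c : ℝ := min κ (g.R g.lo / g.lo) with hc
  have hc0 : 0 < c := lt_min hκ (div_pos hR hlo)
  have hcR : c * g.lo ≤ g.R g.lo := (le_div_iff₀ hlo).1 (min_le_right _ _)
  have hcκ : c ≤ κ := min_le_left _ _
  have hct : 0 < c * t := mul_pos hc0 ht0
  refine ⟨_, ⟨fun θ => if θ ≤ t then c else 0,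
    fun θ => if θ ≤ t then g.R g.lo - c * g.lo else g.R g.lo - c * g.lo + c * t,
    ⟨fun θ _ => ?_, fun θ _ => ?_, fun θ _ θ' _ => ?_, fun θ hθ => ?_⟩, rfl⟩, ?_⟩
  · split_ifs <;> linarith
  · split_ifs <;> linarith
  · split_ifs with h1 h2 h2
    · exact le_rfl
    · linarith [mul_le_mul_of_nonneg_left h1 hc0.le]
    · linarith [mul_le_mul_of_nonneg_left (not_le.1 h1).le hc0.le]
    · exact le_rfl
  · have h1 := hrise θ hθ
    have h2 := mul_le_mul_of_nonneg_right hcκ (sub_nonneg.2 hθ.1)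
    split_ifs with h
    · linarith
    · linarith [mul_le_mul_of_nonneg_left (not_le.1 h).le hc0.le]
  · dsimp only
    rw [expect_step g _ _ ht]
    rw [lt_sub_iff_add_lt, ← lt_sub_iff_add_lt', div_lt_iff₀ ht0] at hcdf
    linarith [mul_lt_mul_of_pos_left hcdf hc0]

/-- If the type distribution is too spread out at the top, screening raises the average of
task `A` above the number of units that exhaust the reservation workload of the highest type. -/
theorem exists_fst_gt (hr : g.RisesFromHighest) (hR : 0 < g.R g.hi) {t : ℝ}
    (ht : t ∈ Icc g.lo g.hi) (hcdf : t / g.hi < g.cdf t) :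
    ∃ n ∈ g.feasibleSet, g.R g.hi / g.hi < n.1 := by
  obtain ⟨κ, hκ, hrise⟩ := hr
  have hlo := g.lo_pos
  have hhi : 0 < g.hi := hlo.trans g.lo_lt_hi
  have ht0 : 0 < t := hlo.trans_le ht.1
  -- The factor `lo * hi` bounds the slope of `c / s`, so participation holds; `c ≤ R hi` gives `α ≥
  -- 0`. The mean of `a` is `α + c / t * cdf t`, to be compared with `α + c / hi`.
  set c : ℝ := min (κ * (g.lo * g.hi)) (g.R g.hi) with hc
  have hc0 : 0 < c := lt_min (by positivity) hR
  have hcR : c ≤ g.R g.hi := min_le_right _ _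
  have hcκ : c ≤ κ * (g.lo * g.hi) := min_le_left _ _
  have hct : 0 < c / t := div_pos hc0 ht0
  have hctt : c / t * t = c := div_mul_cancel₀ _ ht0.ne'
  set α : ℝ := (g.R g.hi - c) / g.hi with hα
  have hα0 : 0 ≤ α := div_nonneg (by linarith) hhi.le
  have hαR : α + c / g.hi = g.R g.hi / g.hi := by rw [hα]; field_simp; ring
  have hbound : ∀ s ∈ Icc g.lo g.hi, α + c / s ≤ g.R g.hi / g.hi + κ * (g.hi - s) := by
    intro s hs
    have hs0 : 0 < s := hlo.trans_le hs.1
    have h1 : c / s - c / g.hi = c * (g.hi - s) / (s * g.hi) := by field_simp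
    have h2 : c * (g.hi - s) / (s * g.hi) ≤ κ * (g.hi - s) := by
      rw [div_le_iff₀ (by positivity)]
      have h3 : g.lo * g.hi ≤ s * g.hi := mul_le_mul_of_nonneg_right hs.1 hhi.le
      have h4 : c ≤ κ * (s * g.hi) := hcκ.trans (mul_le_mul_of_nonneg_left h3 hκ.le)
      linarith [mul_le_mul_of_nonneg_right h4 (sub_nonneg.2 hs.2)]
    linarith
  refine ⟨_, ⟨fun θ => if θ ≤ t then α + c / t else α, fun θ => if θ ≤ t then 0 else c,
    ⟨fun θ _ => ?_, fun θ _ => ?_, fun θ _ θ' _ => ?_, fun θ hθ => ?_⟩, rfl⟩, ?_⟩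
  · split_ifs <;> linarith
  · split_ifs <;> linarith
  · split_ifs with h1 h2 h2
    · exact le_rfl
    · linarith [mul_le_mul_of_nonneg_left h1 hct.le]
    · linarith [mul_le_mul_of_nonneg_left (not_le.1 h1).le hct.le]
    · exact le_rfl
  · have hθ0 : 0 < θ := hlo.trans_le hθ.1
    have hRθ := (le_div_iff₀ hθ0).1 (hrise θ hθ)
    refine le_trans ?_ hRθ
    split_ifs with h
    · have h1 := hbound t ht
      have h2 : κ * (g.hi - t) ≤ κ * (g.hi - θ) := mul_le_mul_of_nonneg_left (by linarith) hκ.le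
      linarith [mul_le_mul_of_nonneg_right (h1.trans (add_le_add_right h2 _)) hθ0.le]
    · have h1 := mul_le_mul_of_nonneg_right (hbound θ hθ) hθ0.le
      rw [add_mul, div_mul_cancel₀ _ hθ0.ne'] at h1
      exact h1
  · dsimp only
    rw [expect_step g _ _ ht]
    have h1 : c / t * (t / g.hi) = c / g.hi := by field_simp
    have h2 := mul_lt_mul_of_pos_left hcdf hct
    linarith

/-- The rise of `R θ / θ` from its value at `hi` makes it positive at `lo`; `exists_snd_gt` needs
this to have room for `c > 0`. -/
theorem R_lo_pos (hr : g.RisesFromHighest) : 0 < g.R g.lo := by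
  obtain ⟨κ, hκ, h⟩ := hr
  have h1 := h _ g.lo_mem
  have hhi : 0 < g.hi := g.lo_pos.trans g.lo_lt_hi
  have h2 := div_nonneg (g.R_nonneg _ g.hi_mem) hhi.le
  have h3 := mul_pos hκ (sub_pos.2 g.lo_lt_hi)
  have h4 : 0 < g.R g.lo / g.lo := by linarith
  rwa [div_pos_iff_of_pos_right g.lo_pos] at h4

theorem R_hi_pos (hr : g.RisesFromLowest) : 0 < g.R g.hi := by
  obtain ⟨κ, hκ, h⟩ := hr
  have h1 := h _ g.hi_mem
  have h2 := g.R_nonneg _ g.lo_mem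
  have h3 := mul_pos hκ (sub_pos.2 g.lo_lt_hi)
  linarith

end WorkerGroup

end

end TaskAllocation

theorem mainTheorem6 (J : ℕ) (hJ : 3 ≤ J) (G : Fin J → TaskAllocation.WorkerGroup)
    (hdistinct : ∀ i j, i ≠ j → (G i).costA ≠ (G j).costA ∧ (G i).costB ≠ (G j).costB)
    (F : Set (ℝ × ℝ)) (hF : ∀ j, (G j).feasibleSet = F) :
    -- the equilibrium set is everything exactly under low heterogeneity
    ((∀ j, (G j).LowHeterogeneity) → TaskAllocation.equilibriumSet G F = F) ∧
    (TaskAllocation.StrictlyConvexFrontier F →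
      (∀ j, (G j).RisesFromLowest ∧ (G j).RisesFromHighest) →
      TaskAllocation.equilibriumSet G F = F → ∀ j, (G j).LowHeterogeneity) ∧
    -- upward-sloping points of the frontier that are not kinks are excluded
    (TaskAllocation.StrictlyConvexFrontier F →
      ∀ x w : ℝ × ℝ, TaskAllocation.IsMaximizer F w x → w.1 * w.2 < 0 →
        ¬ TaskAllocation.IsKink F x →
        (∃ i j, w.1 * ((G i).costB - (G j).costB) ≠ w.2 * ((G i).costA - (G j).costA)) →
        x ∉ TaskAllocation.equilibriumSet G F) ∧
    -- downward-sloping points of the frontier are included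
    (∀ x w : ℝ × ℝ, TaskAllocation.IsMaximizer F w x → 0 ≤ w → w ≠ 0 →
      x ∈ TaskAllocation.equilibriumSet G F) ∧
    -- nonnegativity of a shadow price is preserved when its own quantity increases
    (∀ lA lA' lB : ℝ, lA ≤ lA' → (lA / J, lB / J) ∈ F → (lA' / J, lB / J) ∈ F →
      (0 ≤ TaskAllocation.maxPriceA G (lA, lB) → 0 ≤ TaskAllocation.maxPriceA G (lA', lB)) ∧
      (lA < lA' → ∀ p ∈ TaskAllocation.dualSolutions G (lA, lB), 0 ≤ p.1 →
        ∀ p' ∈ TaskAllocation.dualSolutions G (lA', lB), 0 ≤ p'.1)) ∧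
    (∀ lA lB lB' : ℝ, lB ≤ lB' → (lA / J, lB / J) ∈ F → (lA / J, lB' / J) ∈ F →
      (0 ≤ TaskAllocation.maxPriceB G (lA, lB) → 0 ≤ TaskAllocation.maxPriceB G (lA, lB')) ∧
      (lB < lB' → ∀ p ∈ TaskAllocation.dualSolutions G (lA, lB), 0 ≤ p.2 →
        ∀ p' ∈ TaskAllocation.dualSolutions G (lA, lB'), 0 ≤ p'.2)) := by
  have j₀ : Fin J := ⟨0, by omega⟩
  have hpos : ∀ n ∈ F, 0 ≤ n := fun n hn => by
    rw [← hF j₀] at hn; exact TaskAllocation.WorkerGroup.nonneg_of_mem_feasibleSet hn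
  have h0 : (0 : ℝ × ℝ) ∈ F := by rw [← hF j₀]; exact (G j₀).zero_mem_feasibleSet
  have hc : IsCompact F := by rw [← hF j₀]; exact (G j₀).isCompact_feasibleSet
  refine ⟨fun hlow => ?_, fun hs hrise heq j θ hθ => ?_, fun hs x w hx hw hk ⟨i, j, hij⟩ =>
    TaskAllocation.not_mem_equilibriumSet_of_upward hc hF hs hx hw hk hij,
    fun x w hx hw hw0 => TaskAllocation.mem_equilibriumSet_of_downward hc hF hx hw hw0,
    fun _ _ _ hle _ h => TaskAllocation.maxPriceA_mono hc hF (by omega) hle h,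
    fun _ _ _ hle _ h => TaskAllocation.maxPriceB_mono hc hF (by omega) hle h⟩
  · refine TaskAllocation.equilibriumSet_eq_of_dominated hc hF hpos h0 ?_ ?_
    · rw [← hF j₀]
      exact fun n hn => TaskAllocation.WorkerGroup.exists_fst_dominating (hlow j₀) hn
    · rw [← hF j₀]
      exact fun n hn => TaskAllocation.WorkerGroup.exists_snd_dominating (hlow j₀) hn
  · have h01 : (⟨0, by omega⟩ : Fin J) ≠ ⟨1, by omega⟩ := by simp
    obtain ⟨hA, hB⟩ := hdistinct _ _ h01
    constructor
    · by_contra! hlt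
      obtain ⟨m, hm, hRm⟩ := TaskAllocation.WorkerGroup.exists_snd_gt (hrise j).1
        (TaskAllocation.WorkerGroup.R_lo_pos (hrise j).2) hθ hlt
      rw [hF j] at hm
      obtain ⟨n, hn, hn1, hmn⟩ := TaskAllocation.exists_le_snd_of_equilibriumSet_eq hc hF hs hpos
        h0 hB heq hm
      rw [← hF j] at hn
      linarith [TaskAllocation.WorkerGroup.snd_le_of_fst_eq_zero hn hn1]
    · by_contra! hlt
      obtain ⟨m, hm, hRm⟩ := TaskAllocation.WorkerGroup.exists_fst_gt (hrise j).2
        (TaskAllocation.WorkerGroup.R_hi_pos (hrise j).1) hθ hlt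
      rw [hF j] at hm
      obtain ⟨n, hn, hn1, hmn⟩ := TaskAllocation.exists_le_fst_of_equilibriumSet_eq hc hF hs hpos
        h0 hA heq hm
      rw [← hF j] at hn
      linarith [TaskAllocation.WorkerGroup.fst_le_of_snd_eq_zero hn hn1]
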